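/- Let $(X,\mathscr{B},\mu)$ be a probability space and let $T\colon X\to X$ be a measure-preserving transformation which is weakly mixing, i.e. $\frac1N\sum_{n=1}^N|\mu(A\cap T^{-n}B)-\mu(A)\mu(B)|\to 0$ as $N\to\infty$ for all $A,B\in\mathscr{B}$. Let $I$ be an arbitrary index set, $r$ a non-negative integer, and let $(p_i^{(t)})_{i=1}^r$, $t\in I$, be a uniformly admissible family of sequences of polynomials in $\mathbb{Z}[x]$; that is, for all $i$ and all $j\neq i$ the polynomials $p_i^{(t)}$ and $p_i^{(t)}-p_j^{(t)}$ are non-constant, and their degrees and leading coefficients do not depend on $t$. Let $f_1,\dots,f_r\in L^\infty(\mu)$ (real- or complex-valued), and write $T^kf=f\circ T^k$. Then $$\frac1N\sum_{n=1}^N\ \prod_{i=1}^r T^{p_i^{(t)}(n)}f_i\ \longrightarrow\ \prod_{i=1}^r\int f_i\,d\mu\quad\text{in }L^2(\mu)\text{ as }N\to\infty,\text{ uniformly in }t.$$ Precisely: for every $\varepsilon>0$ there is $N_0$ such that for all $N\ge N_0$ and all $t\in I$ for which the average is defined, $$\Big\|\frac1N\sum_{n=1}^N\prod_{i=1}^r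 T^{p_i^{(t)}(n)}f_i-\prod_{i=1}^r\int f_i\,d\mu\Big\|_{L^2(\mu)}<\varepsilon .$$ Here the average is defined for all $t$ and $N$ if $T$ is invertible (with measurable inverse), and for general $T$ it is defined for those $t$ and $N$ with $p_i^{(t)}(n)\ge 0$ for all $1\le i\le r$ and $1\le n\le N$. -/

import Mathlib

open MeasureTheory Filter Topology

/-- The transformation `T` preserves `μ` and is weakly mixing:
`𝔼_{n ≤ N} |μ (A ∩ T⁻ⁿ B) - μ A * μ B| → 0` for all measurable `A`, `B`. -/
structure IsWeaklyMixing {X : Type*} [MeasurableSpace X] (T : X → X) (μ : Measure X) : Prop where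
  measurePreserving : MeasurePreserving T μ μ
  tendsto_average : ∀ A B : Set X, MeasurableSet A → MeasurableSet B →
    Tendsto (fun N : ℕ => (N : ℝ)⁻¹ *
      ∑ n ∈ Finset.Icc 1 N, |μ.real (A ∩ T^[n] ⁻¹' B) - μ.real A * μ.real B|) atTop (𝓝 0)

/-- `T` is invertible: it has a two-sided measurable inverse. -/
def IsInvertibleMap {X : Type*} [MeasurableSpace X] (T : X → X) : Prop :=
  ∃ S : X → X, Measurable S ∧ Function.LeftInverse S T ∧ Function.RightInverse S T

/-- The integer power `T ^ k`: the `k`-th iterate of `T` if `0 ≤ k`, and the `|k|`-th iterate of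
the inverse of `T` if `k < 0`. (For `k < 0` it is only used for invertible `T`.) -/
noncomputable def intIterate {X : Type*} (T : X → X) (k : ℤ) (x : X) : X :=
  match k with
  | .ofNat n => T^[n] x
  | .negSucc n => (@Function.invFun X X ⟨x⟩ T)^[n + 1] x

theorem intIterate_natCast {X : Type*} (T : X → X) (n : ℕ) :
    intIterate T (n : ℤ) = T^[n] := rfl

theorem intIterate_neg_natCast {X : Type*} {T S : X → X} (h₁ : Function.LeftInverse S T)
    (h₂ : Function.RightInverse S T) (n : ℕ) : intIterate T (-(n : ℤ)) = S^[n] := by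
  funext x
  cases n with
  | zero => rfl
  | succ n =>
    have h : @Function.invFun X X ⟨x⟩ T = S := by
      funext y
      apply h₁.injective
      rw [h₂ y]
      exact @Function.invFun_eq X X ⟨x⟩ T y ⟨S y, h₂ y⟩
    change (@Function.invFun X X ⟨x⟩ T)^[n + 1] x = S^[n + 1] x
    rw [h]

/-- A family `p t = (p t 1, …, p t r)`, `t ∈ I`, of sequences of integer polynomials is uniformly
admissible: all `p t i` and all differences `p t i - p t j` with `i ≠ j` are non-constant, and
their degrees and leading coefficients do not depend on `t`. -/
structure UniformlyAdmissible {I : Type*} {r : ℕ} (p : I → Fin r → Polynomial ℤ) : Prop where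
  natDegree_pos : ∀ t i, 0 < (p t i).natDegree
  natDegree_eq : ∀ s t i, (p s i).natDegree = (p t i).natDegree
  leadingCoeff_eq : ∀ s t i, (p s i).leadingCoeff = (p t i).leadingCoeff
  natDegree_sub_pos : ∀ t i j, i ≠ j → 0 < (p t i - p t j).natDegree
  natDegree_sub_eq : ∀ s t i j, i ≠ j →
    (p s i - p s j).natDegree = (p t i - p t j).natDegree
  leadingCoeff_sub_eq : ∀ s t i j, i ≠ j →
    (p s i - p s j).leadingCoeff = (p t i - p t j).leadingCoeff

/-- The average `𝔼_{1 ≤ n ≤ N} ∏ i, T ^ (q i n) (f i)`, where `(T ^ k) f = f ∘ T ^ k`. -/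
noncomputable def polyAverage {X 𝕜 : Type*} [RCLike 𝕜] {r : ℕ} (T : X → X)
    (q : Fin r → Polynomial ℤ) (f : Fin r → X → 𝕜) (N : ℕ) (x : X) : 𝕜 :=
  (N : 𝕜)⁻¹ * ∑ n ∈ Finset.Icc 1 N, ∏ i, f i (intIterate T ((q i).eval (n : ℤ)) x)

/-!
The proof is Bergelson's PET induction, run uniformly over a class of polynomial systems.

*Uniformity.* Fix degrees and leading coefficients for every member `p i` and every difference
`p i - p j` of a system (`LeadingData`). All systems with these data are treated at once, and the
bound `N₀` depends on the data and the functions only. Adding a constant to all members of a system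
does not change its data and replaces the average `A` by `A ∘ T ^ K`, whose `L²` distance to a
constant is the same. So exponents can always be made non-negative; this is why neither
invertibility of `T` nor an invertible extension is needed in the induction, and why the
invertible case reduces to natural exponents.

*Induction.* The weight of a system counts, for each degree, the leading coefficients that occur,
compared lexicographically from the top degree. If `q` consists of shifts `p i (n + s)` of the
members of `p`, and `q j₀` has minimal degree, then the system of the `q j - q j₀` has smaller
weight (`LeadingData.weightLT_of_differences`). Factoring out `T ^ (q j₀ n)` and using the
Cauchy–Schwarz inequality, convergence for the smaller system gives convergence of the means of
`∫ ∏ j, T ^ (q j n) (g j)` to `∏ j, ∫ g j`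
(`ConvergesBelow.exists_norm_mean_integral_sub_le`).

*Inductive step.* With `L = ∏ i, ∫ f i`, expand `‖A - L‖² = ‖A‖² - 2 Re ⟨A, L⟩ + |L|²` in `L²`. The
factoring argument, for `q = p`, gives `∫ A → L`. The van der Corput inequality bounds `‖A‖²` by
an average over `h, h' ≤ H` of correlations of the `n + h`-th and the `n + h'`-th product. For a
nonlinear `p i`, both `p i (n + h)` and `p i (n + h')` enter the system `q`; for a linear one they
differ by a constant and are merged into a single function. Unless `|h - h'|` is small, the
differences within `q` again have fixed leading terms (`exists_leadsWith_taylor_sub_taylor`), and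
the correlation tends to `|L|²` up to terms `∫ T ^ k f · conj f - |∫ f|²` from the linear members
(`exists_re_mean_integral_mul_conj_le`). By weak mixing these terms vanish in the mean over
`h, h'` (`IsWeaklyMixing.nullInMean_correlation`).
-/

/-! ### Leading terms of integer polynomials -/

/-- `P` is a non-constant polynomial with degree `d` and leading coefficient `c`. -/
structure LeadsWith (P : Polynomial ℤ) (d : ℕ) (c : ℤ) : Prop where
  deg_pos : 0 < d
  ne_zero : c ≠ 0
  natDegree_le : P.natDegree ≤ d
  coeff_eq : P.coeff d = c

namespace LeadsWith

variable {P Q : Polynomial ℤ} {d e : ℕ} {b c : ℤ}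

theorem natDegree_eq (h : LeadsWith P d c) : P.natDegree = d :=
  le_antisymm h.natDegree_le
    (Polynomial.le_natDegree_of_ne_zero (by rw [h.coeff_eq]; exact h.ne_zero))

theorem deg_unique (h : LeadsWith P d c) (h' : LeadsWith P e b) : d = e :=
  h.natDegree_eq.symm.trans h'.natDegree_eq

theorem lead_unique (h : LeadsWith P d c) (h' : LeadsWith P e b) : c = b := by
  rw [← h.coeff_eq, ← h'.coeff_eq, h.deg_unique h']

theorem of_leadingCoeff_eq (hd : 0 < P.natDegree) : LeadsWith P P.natDegree P.leadingCoeff :=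
  ⟨hd, fun h => by simp [Polynomial.leadingCoeff_eq_zero.1 h] at hd, le_rfl, rfl⟩

theorem add_of_natDegree_lt (h : LeadsWith P d c) (hQ : Q.natDegree < d) :
    LeadsWith (P + Q) d c where
  deg_pos := h.deg_pos
  ne_zero := h.ne_zero
  natDegree_le := Polynomial.natDegree_add_le_of_degree_le h.natDegree_le hQ.le
  coeff_eq := by
    rw [Polynomial.coeff_add, h.coeff_eq, Polynomial.coeff_eq_zero_of_natDegree_lt hQ, add_zero]

theorem sub_of_natDegree_lt (h : LeadsWith P d c) (hQ : Q.natDegree < d) :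
    LeadsWith (P - Q) d c := by
  rw [sub_eq_add_neg]
  exact h.add_of_natDegree_lt (by rwa [Polynomial.natDegree_neg])

theorem sub_of_lead_ne (h : LeadsWith P d c) (h' : LeadsWith Q d b) (hcb : c ≠ b) :
    LeadsWith (P - Q) d (c - b) where
  deg_pos := h.deg_pos
  ne_zero := sub_ne_zero.2 hcb
  natDegree_le := (Polynomial.natDegree_sub_le_iff_left h'.natDegree_le).2 h.natDegree_le
  coeff_eq := by rw [Polynomial.coeff_sub, h.coeff_eq, h'.coeff_eq]

theorem natDegree_sub_lt (h : LeadsWith P d c) (h' : LeadsWith Q d c) :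
    (P - Q).natDegree < d := by
  refine lt_of_le_of_ne
    ((Polynomial.natDegree_sub_le_iff_left h'.natDegree_le).2 h.natDegree_le) fun h0 => ?_
  have h1 : (P - Q).leadingCoeff = 0 := by
    rw [Polynomial.leadingCoeff, h0, Polynomial.coeff_sub, h.coeff_eq, h'.coeff_eq, sub_self]
  rw [Polynomial.leadingCoeff_eq_zero.1 h1, Polynomial.natDegree_zero] at h0
  exact h.deg_pos.ne h0

theorem taylor (h : LeadsWith P d c) (s : ℤ) : LeadsWith (Polynomial.taylor s P) d c where
  deg_pos := h.deg_pos
  ne_zero := h.ne_zero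
  natDegree_le := by rw [Polynomial.natDegree_taylor]; exact h.natDegree_le
  coeff_eq := by
    have := Polynomial.coeff_taylor_natDegree (f := P) (r := s)
    rwa [Polynomial.leadingCoeff, h.natDegree_eq, h.coeff_eq] at this

theorem natDegree_taylor_sub_taylor_le (h : LeadsWith P d c) (s s' : ℤ) :
    (Polynomial.taylor s P - Polynomial.taylor s' P).natDegree ≤ d - 1 := by
  have := (h.taylor s).natDegree_sub_lt (h.taylor s')
  omega

theorem coeff_taylor_pred (h : LeadsWith P d c) (s : ℤ) :
    (Polynomial.taylor s P).coeff (d - 1) = P.coeff (d - 1) + d * c * s := by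
  obtain ⟨k, rfl⟩ : ∃ k, d = k + 1 := ⟨d - 1, by have := h.deg_pos; omega⟩
  have hdeg : (Polynomial.hasseDeriv k P).natDegree < 2 := by
    have := Polynomial.natDegree_hasseDeriv_le P k
    have := h.natDegree_le
    omega
  rw [Polynomial.taylor_coeff, Nat.add_sub_cancel, Polynomial.eval_eq_sum_range' hdeg]
  simp only [Finset.sum_range_succ, Finset.sum_range_zero, Polynomial.hasseDeriv_coeff]
  rw [add_comm 1 k, h.coeff_eq]
  simp

theorem coeff_taylor_sub_taylor (h : LeadsWith P d c) (s s' : ℤ) :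
    (Polynomial.taylor s P - Polynomial.taylor s' P).coeff (d - 1) = d * c * (s - s') := by
  rw [Polynomial.coeff_sub, h.coeff_taylor_pred, h.coeff_taylor_pred]
  ring

theorem taylor_sub_taylor (h : LeadsWith P d c) (hd : d ≠ 1) {s s' : ℤ} (hs : s ≠ s') :
    LeadsWith (Polynomial.taylor s P - Polynomial.taylor s' P) (d - 1) (d * c * (s - s')) where
  deg_pos := by have := h.deg_pos; omega
  ne_zero := mul_ne_zero (mul_ne_zero (by have := h.deg_pos; omega) h.ne_zero) (sub_ne_zero.2 hs)
  natDegree_le := h.natDegree_taylor_sub_taylor_le s s'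
  coeff_eq := h.coeff_taylor_sub_taylor s s'

end LeadsWith

/-- The leading term of `P (X + s) - Q (X + s')` depends only on those of `P - Q` and `Q`, unless
`s - s'` is one of finitely many values: `P (X + s) - Q (X + s')` is the sum of
`(P - Q) (X + s)` and `Q (X + s) - Q (X + s')`, and the bound on `|b|` excludes that the
leading terms of the two cancel. -/
theorem exists_leadsWith_taylor_sub_taylor (d e : ℕ) (b c : ℤ) {s s' : ℤ}
    (hs : s = s' ∨ |b| < |s - s'|) :
    ∃ (e' : ℕ) (b' : ℤ), ∀ P Q : Polynomial ℤ, LeadsWith (P - Q) e b → LeadsWith Q d c →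
      LeadsWith (Polynomial.taylor s P - Polynomial.taylor s' Q) e' b' := by
  have key : ∀ P Q : Polynomial ℤ, Polynomial.taylor s P - Polynomial.taylor s' Q =
      Polynomial.taylor s (P - Q) + (Polynomial.taylor s Q - Polynomial.taylor s' Q) := by
    intro P Q; rw [map_sub]; ring
  rcases eq_or_ne s s' with rfl | hne
  · refine ⟨e, b, fun P Q h _ => ?_⟩
    rw [← map_sub]
    exact h.taylor s
  replace hs : |b| < |s - s'| := hs.resolve_left hne
  rcases lt_trichotomy (d - 1) e with hlt | heq | hgt
  · refine ⟨e, b, fun P Q h hQ => ?_⟩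
    rw [key]
    exact (h.taylor s).add_of_natDegree_lt
      ((hQ.natDegree_taylor_sub_taylor_le s s').trans_lt hlt)
  · refine ⟨e, b + d * c * (s - s'), fun P Q h hQ => ?_⟩
    rw [key]
    refine ⟨h.deg_pos, fun h0 => ?_, ?_, ?_⟩
    · have h1 : |b| = |(d * c : ℤ)| * |s - s'| := by
        rw [← abs_mul, ← abs_neg b]; congr 1; linarith
      have h2 : (1 : ℤ) ≤ |(d * c : ℤ)| :=
        Int.one_le_abs (mul_ne_zero (by have := hQ.deg_pos; omega) hQ.ne_zero)
      nlinarith [abs_nonneg (s - s')]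
    · refine Polynomial.natDegree_add_le_of_degree_le (h.taylor s).natDegree_le ?_
      rw [← heq]
      exact hQ.natDegree_taylor_sub_taylor_le s s'
    · rw [Polynomial.coeff_add, (h.taylor s).coeff_eq, ← heq, hQ.coeff_taylor_sub_taylor]
  · refine ⟨d - 1, d * c * (s - s'), fun P Q h hQ => ?_⟩
    rw [key, add_comm]
    have := h.deg_pos
    refine (hQ.taylor_sub_taylor (by omega) hne).add_of_natDegree_lt ?_
    rw [Polynomial.natDegree_taylor]
    exact h.natDegree_le.trans_lt hgt

/-! ### Systems of polynomials with prescribed leading terms -/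

/-- Prescribed degrees and leading coefficients for the members of a system of polynomials indexed
by `ι` and for their pairwise differences. The diagonal values of `degSub` and `leadSub` are
not constrained by `Admits`. -/
structure LeadingData (ι : Type) where
  deg : ι → ℕ
  lead : ι → ℤ
  degSub : ι → ι → ℕ
  leadSub : ι → ι → ℤ

namespace LeadingData

variable {ι : Type}

/-- The members of the system `p`, and their differences, have the leading terms prescribed by
`D`. -/
structure Admits (D : LeadingData ι) (p : ι → Polynomial ℤ) : Prop where
  leadsWith : ∀ i, LeadsWith (p i) (D.deg i) (D.lead i)
  leadsWith_sub : ∀ i j, i ≠ j → LeadsWith (p i - p j) (D.degSub i j) (D.leadSub i j)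

theorem Admits.add_C {D : LeadingData ι} {p : ι → Polynomial ℤ} (h : D.Admits p) (k : ℤ) :
    D.Admits fun i => p i + Polynomial.C k where
  leadsWith i := (h.leadsWith i).add_of_natDegree_lt
    (by rw [Polynomial.natDegree_C]; exact (h.leadsWith i).deg_pos)
  leadsWith_sub i j hij := by
    rw [add_sub_add_right_eq_sub]
    exact h.leadsWith_sub i j hij

/-- The leading coefficients that occur in degree `e`. -/
def leadsInDegree [Fintype ι] (D : LeadingData ι) (e : ℕ) : Finset ℤ :=
  (Finset.univ.filter fun i => D.deg i = e).image D.lead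

theorem mem_leadsInDegree [Fintype ι] {D : LeadingData ι} {e : ℕ} {c : ℤ} :
    c ∈ D.leadsInDegree e ↔ ∃ i, D.deg i = e ∧ D.lead i = c := by
  simp [leadsInDegree]

/-- The number of leading coefficients that occur in each degree, for degrees up to `m`. -/
def weight [Fintype ι] (D : LeadingData ι) (m : ℕ) : Fin (m + 1) → ℕ :=
  fun e => (D.leadsInDegree e).card

/-- The lexicographic order on weights in which the highest degree is compared first. -/
def WeightLT (m : ℕ) : (Fin (m + 1) → ℕ) → (Fin (m + 1) → ℕ) → Prop :=
  Pi.Lex (· > ·) (fun {_} => (· < ·))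

theorem wellFounded_weightLT (m : ℕ) : WellFounded (WeightLT m) :=
  Pi.Lex.wellFounded _ fun _ => wellFounded_lt

/-- The descent step of the PET induction. Subtracting a member of minimal degree `d` keeps all
members of degree greater than `d`, translates the leading coefficients in degree `d`, and
sends the members whose leading term is that of the subtracted one to lower degrees, so that one
leading coefficient is lost in degree `d`. -/
theorem weightLT_of_differences {J : Type} [Fintype ι] [Fintype J] [DecidableEq J]
    {D : LeadingData ι} {p : ι → Polynomial ℤ} (hp : D.Admits p) {m : ℕ} (hm : ∀ i, D.deg i ≤ m)
    {π : J → ι} (hπ : Function.Surjective π) (s : J → ℤ) (j₀ : J)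
    (hj₀ : ∀ i, D.deg (π j₀) ≤ D.deg i) {D' : LeadingData {j // j ≠ j₀}}
    (hD' : D'.Admits fun j =>
      Polynomial.taylor (s j) (p (π j)) - Polynomial.taylor (s j₀) (p (π j₀))) :
    (∀ j, D'.deg j ≤ m) ∧ WeightLT m (D'.weight m) (D.weight m) := by
  obtain ⟨d, hd⟩ : ∃ d, d = D.deg (π j₀) := ⟨_, rfl⟩
  rw [← hd] at hj₀
  have hq : ∀ j, LeadsWith (Polynomial.taylor (s j) (p (π j))) (D.deg (π j)) (D.lead (π j)) :=
    fun j => (hp.leadsWith _).taylor _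
  have hq₀ : LeadsWith (Polynomial.taylor (s j₀) (p (π j₀))) d (D.lead (π j₀)) := hd ▸ hq j₀
  have high : ∀ j, d < D.deg (π j.1) → D'.deg j = D.deg (π j.1) ∧ D'.lead j = D.lead (π j.1) := by
    intro j hj
    have h1 := (hq j.1).sub_of_natDegree_lt (hq₀.natDegree_le.trans_lt hj)
    exact ⟨(hD'.leadsWith j).deg_unique h1, (hD'.leadsWith j).lead_unique h1⟩
  have same : ∀ j, D.deg (π j.1) = d → D.lead (π j.1) ≠ D.lead (π j₀) →
      D'.deg j = d ∧ D'.lead j = D.lead (π j.1) - D.lead (π j₀) := by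
    intro j hj hne
    have h0 := hq j.1
    rw [hj] at h0
    have h1 := h0.sub_of_lead_ne hq₀ hne
    exact ⟨(hD'.leadsWith j).deg_unique h1, (hD'.leadsWith j).lead_unique h1⟩
  have low : ∀ j, D.deg (π j.1) = d → D.lead (π j.1) = D.lead (π j₀) → D'.deg j < d := by
    intro j hj heq
    have h0 := hq j.1
    rw [hj, heq] at h0
    have h1 := h0.natDegree_sub_lt hq₀
    rwa [(hD'.leadsWith j).natDegree_eq] at h1
  refine ⟨fun j => ?_, ⟨d, Nat.lt_succ_of_le (hd ▸ hm _)⟩, fun e he => ?_, ?_⟩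
  · rcases (hj₀ (π j.1)).lt_or_eq with h | h
    · exact (high j h).1.trans_le (hm _)
    · by_cases hl : D.lead (π j.1) = D.lead (π j₀)
      · exact (low j h.symm hl).le.trans (hd ▸ hm _)
      · exact (same j h.symm hl).1.trans_le (hd ▸ hm _)
  · replace he : d < e := he
    refine congrArg Finset.card (Finset.ext fun c => ?_)
    rw [mem_leadsInDegree, mem_leadsInDegree]
    constructor
    · rintro ⟨j, hj, rfl⟩
      rcases (hj₀ (π j.1)).lt_or_eq with h | h
      · exact ⟨π j.1, (high j h).1.symm.trans hj, (high j h).2.symm⟩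
      · by_cases hl : D.lead (π j.1) = D.lead (π j₀)
        · have := low j h.symm hl
          omega
        · have := (same j h.symm hl).1
          omega
    · rintro ⟨i, hi, rfl⟩
      obtain ⟨j, rfl⟩ := hπ i
      have hne : j ≠ j₀ := by rintro rfl; omega
      have := high ⟨j, hne⟩ (by change d < D.deg (π j); omega)
      exact ⟨⟨j, hne⟩, this.1.trans hi, this.2⟩
  · have hsub : (D'.leadsInDegree d).image (· + D.lead (π j₀)) ⊂ D.leadsInDegree d := by
      refine (Finset.ssubset_iff_of_subset ?_).2
        ⟨D.lead (π j₀), mem_leadsInDegree.2 ⟨π j₀, hd.symm, rfl⟩, fun h => ?_⟩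
      · intro b hb
        obtain ⟨c, hc, rfl⟩ := Finset.mem_image.1 hb
        obtain ⟨j, hj, rfl⟩ := mem_leadsInDegree.1 hc
        rcases (hj₀ (π j.1)).lt_or_eq with h | h
        · have := (high j h).1
          exact absurd (this.symm.trans hj) h.ne'
        · by_cases hl : D.lead (π j.1) = D.lead (π j₀)
          · have := low j h.symm hl
            omega
          · rw [(same j h.symm hl).2, sub_add_cancel]
            exact mem_leadsInDegree.2 ⟨_, h.symm, rfl⟩
      · obtain ⟨c, hc, h0⟩ := Finset.mem_image.1 h
        obtain ⟨j, -, hj⟩ := mem_leadsInDegree.1 hc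
        exact (hD'.leadsWith j).ne_zero (by rw [hj]; linarith)
    have := Finset.card_lt_card hsub
    rwa [Finset.card_image_of_injective _ (add_left_injective _)] at this

end LeadingData

/-! ### Sequences that vanish in the mean -/

/-- The Cesàro means of `φ` over `1, …, N` tend to zero. -/
def NullInMean (φ : ℕ → ℝ) : Prop :=
  Tendsto (fun N : ℕ => (N : ℝ)⁻¹ * ∑ n ∈ Finset.Icc 1 N, φ n) atTop (𝓝 0)

namespace NullInMean

variable {φ ψ : ℕ → ℝ}

theorem add (hφ : NullInMean φ) (hψ : NullInMean ψ) : NullInMean fun n => φ n + ψ n := by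
  have := Tendsto.add hφ hψ
  simpa only [NullInMean, Finset.sum_add_distrib, mul_add, add_zero] using this

theorem const_mul (hφ : NullInMean φ) (c : ℝ) : NullInMean fun n => c * φ n := by
  have := Tendsto.const_mul c hφ
  simpa only [NullInMean, ← Finset.mul_sum, mul_left_comm, mul_zero] using this

theorem sum {κ : Type*} {s : Finset κ} {Φ : κ → ℕ → ℝ} (h : ∀ k ∈ s, NullInMean (Φ k)) :
    NullInMean fun n => ∑ k ∈ s, Φ k n := by
  classical
  induction s using Finset.induction_on with
  | empty => simp [NullInMean]
  | insert a s ha ih =>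
    simp only [Finset.sum_insert ha]
    exact (h a (Finset.mem_insert_self a s)).add
      (ih fun k hk => h k (Finset.mem_insert_of_mem hk))

theorem of_le (h0 : ∀ n, 0 ≤ φ n) (h : ∀ ε > 0, ∃ ψ, NullInMean ψ ∧ ∀ n, φ n ≤ ψ n + ε) :
    NullInMean φ := by
  refine Metric.tendsto_nhds.2 fun ε hε => ?_
  obtain ⟨ψ, hψ, hle⟩ := h (ε / 2) (half_pos hε)
  filter_upwards [Metric.tendsto_nhds.1 hψ (ε / 2) (half_pos hε)] with N hN
  rw [Real.dist_0_eq_abs] at hN ⊢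
  have hN' := (abs_lt.1 hN).2
  rw [abs_of_nonneg (mul_nonneg (by positivity) (Finset.sum_nonneg fun n _ => h0 n))]
  calc (N : ℝ)⁻¹ * ∑ n ∈ Finset.Icc 1 N, φ n
      ≤ (N : ℝ)⁻¹ * ∑ n ∈ Finset.Icc 1 N, (ψ n + ε / 2) := by
        gcongr with n _; exact hle n
    _ = (N : ℝ)⁻¹ * ∑ n ∈ Finset.Icc 1 N, ψ n + (N : ℝ)⁻¹ * N * (ε / 2) := by
        rw [Finset.sum_add_distrib, Finset.sum_const, Nat.card_Icc]; simp; ring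
    _ ≤ (N : ℝ)⁻¹ * ∑ n ∈ Finset.Icc 1 N, ψ n + 1 * (ε / 2) := by
        gcongr; exact inv_mul_le_one
    _ < ε := by linarith

theorem indicator_lt (M : ℕ) : NullInMean fun n => if n < M then 1 else 0 := by
  have h : Tendsto (fun N : ℕ => (N : ℝ)⁻¹ * M) atTop (𝓝 0) := by
    simpa using tendsto_inv_atTop_nhds_zero_nat (𝕜 := ℝ) |>.mul_const (M : ℝ)
  refine squeeze_zero (fun N => mul_nonneg (by positivity)
    (Finset.sum_nonneg fun n _ => by split_ifs <;> norm_num)) (fun N => ?_) h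
  gcongr
  rw [Finset.sum_ite, Finset.sum_const_zero, add_zero, Finset.sum_const, nsmul_eq_mul, mul_one]
  have : ((Finset.Icc 1 N).filter (· < M)).card ≤ (Finset.range M).card :=
    Finset.card_le_card fun n hn => Finset.mem_range.2 (Finset.mem_filter.1 hn).2
  rw [Finset.card_range] at this
  exact_mod_cast this

theorem comp_mul (hφ : NullInMean φ) (h0 : ∀ n, 0 ≤ φ n) {a : ℕ} (ha : 0 < a) :
    NullInMean fun n => φ (a * n) := by
  have hlim : Tendsto (fun N : ℕ => (a : ℝ) * (((a * N : ℕ) : ℝ)⁻¹ *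
      ∑ n ∈ Finset.Icc 1 (a * N), φ n)) atTop (𝓝 0) := by
    have := (Tendsto.comp hφ (tendsto_id.const_mul_atTop' ha)).const_mul (a : ℝ)
    simpa only [mul_zero, Function.comp_def, id] using this
  refine squeeze_zero (fun N => mul_nonneg (by positivity)
    (Finset.sum_nonneg fun n _ => h0 _)) (fun N => ?_) hlim
  have ha' : (a : ℝ) ≠ 0 := by positivity
  rw [Nat.cast_mul, mul_inv, ← mul_assoc, ← mul_assoc, mul_inv_cancel₀ ha', one_mul]
  gcongr
  rw [← Finset.sum_image (f := φ) (g := fun n => a * n)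
    (fun x _ y _ h => Nat.eq_of_mul_eq_mul_left ha h)]
  refine Finset.sum_le_sum_of_subset_of_nonneg (fun n hn => ?_) fun n _ _ => h0 n
  obtain ⟨k, hk, rfl⟩ := Finset.mem_image.1 hn
  rw [Finset.mem_Icc] at hk ⊢
  exact ⟨Nat.mul_pos ha hk.1, Nat.mul_le_mul_left a hk.2⟩

/-- Every difference `|h - h'|` occurs at most twice in each row, so averages of `φ |h - h'|` over
squares are controlled by the Cesàro means of `φ`. -/
theorem exists_double_average_le (hφ : NullInMean φ) (h0 : ∀ n, 0 ≤ φ n) {ε : ℝ} (hε : 0 < ε) :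
    ∃ H : ℕ, 0 < H ∧ ((H : ℝ) ^ 2)⁻¹ *
      ∑ h ∈ Finset.Icc 1 H, ∑ h' ∈ Finset.Icc 1 H, φ (Nat.dist h h') ≤ ε := by
  have h1 : Tendsto (fun N : ℕ => (N : ℝ)⁻¹ * φ 0 + 2 * ((N : ℝ)⁻¹ *
      ∑ n ∈ Finset.Icc 1 N, φ n)) atTop (𝓝 0) := by
    simpa using (tendsto_inv_atTop_nhds_zero_nat (𝕜 := ℝ) |>.mul_const (φ 0)).add
      (Tendsto.const_mul 2 hφ)
  obtain ⟨H, hH, hH1⟩ := ((h1.eventually_le_const hε).and (eventually_ge_atTop 1)).exists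
  refine ⟨H, hH1, le_trans ?_ hH⟩
  have hHpos : (0 : ℝ) < H := by exact_mod_cast hH1
  have row : ∀ h ∈ Finset.Icc 1 H, ∑ h' ∈ Finset.Icc 1 H, φ (Nat.dist h h') ≤
      φ 0 + 2 * ∑ n ∈ Finset.Icc 1 H, φ n := by
    intro h hh
    rw [Finset.mem_Icc] at hh
    -- On each side of the diagonal, `h' ↦ |h - h'|` is injective with values in `1, …, H`.
    have hsplit : Finset.Icc 1 H = (Finset.Icc 1 H).filter (· < h) ∪
        ({h} ∪ (Finset.Icc 1 H).filter (h < ·)) := by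
      ext n; simp only [Finset.mem_union, Finset.mem_filter, Finset.mem_Icc, Finset.mem_singleton]
      omega
    have hlow : ∑ h' ∈ (Finset.Icc 1 H).filter (· < h), φ (Nat.dist h h') ≤
        ∑ n ∈ Finset.Icc 1 H, φ n := by
      rw [← Finset.sum_image (f := φ) (g := fun n => Nat.dist h n)]
      · refine Finset.sum_le_sum_of_subset_of_nonneg (fun n hn => ?_) fun n _ _ => h0 n
        obtain ⟨k, hk, rfl⟩ := Finset.mem_image.1 hn
        simp only [Finset.mem_filter, Finset.mem_Icc, Nat.dist] at hk ⊢
        omega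
      · intro x hx y hy hxy
        simp only [Finset.coe_filter, Set.mem_ofPred_eq, Nat.dist] at hx hy hxy
        omega
    have hhigh : ∑ h' ∈ (Finset.Icc 1 H).filter (h < ·), φ (Nat.dist h h') ≤
        ∑ n ∈ Finset.Icc 1 H, φ n := by
      rw [← Finset.sum_image (f := φ) (g := fun n => Nat.dist h n)]
      · refine Finset.sum_le_sum_of_subset_of_nonneg (fun n hn => ?_) fun n _ _ => h0 n
        obtain ⟨k, hk, rfl⟩ := Finset.mem_image.1 hn
        simp only [Finset.mem_filter, Finset.mem_Icc, Nat.dist] at hk ⊢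
        omega
      · intro x hx y hy hxy
        simp only [Finset.coe_filter, Set.mem_ofPred_eq, Nat.dist] at hx hy hxy
        omega
    rw [hsplit, Finset.sum_union, Finset.sum_union, Finset.sum_singleton, Nat.dist_self]
    · rw [← hsplit]
      linarith
    · rw [Finset.disjoint_left]; intro n; simp only [Finset.mem_filter, Finset.mem_singleton]
      omega
    · rw [Finset.disjoint_left]; intro n
      simp only [Finset.mem_union, Finset.mem_filter, Finset.mem_singleton]
      omega
  calc ((H : ℝ) ^ 2)⁻¹ * ∑ h ∈ Finset.Icc 1 H, ∑ h' ∈ Finset.Icc 1 H, φ (Nat.dist h h')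
      ≤ ((H : ℝ) ^ 2)⁻¹ * ∑ h ∈ Finset.Icc 1 H, (φ 0 + 2 * ∑ n ∈ Finset.Icc 1 H, φ n) := by
        gcongr with h hh; exact row h hh
    _ = (H : ℝ)⁻¹ * φ 0 + 2 * ((H : ℝ)⁻¹ * ∑ n ∈ Finset.Icc 1 H, φ n) := by
        rw [Finset.sum_const, Nat.card_Icc, Nat.add_sub_cancel, nsmul_eq_mul]
        field_simp

end NullInMean

/-! ### Cesàro means and the van der Corput inequality -/

section Mean

variable {𝕜 : Type*} [RCLike 𝕜]

/-- The average of `a` over `1, …, N`. -/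
noncomputable def mean (N : ℕ) (a : ℕ → 𝕜) : 𝕜 :=
  (N : 𝕜)⁻¹ * ∑ n ∈ Finset.Icc 1 N, a n

theorem re_mean (N : ℕ) (a : ℕ → 𝕜) :
    RCLike.re (mean N a) = (N : ℝ)⁻¹ * ∑ n ∈ Finset.Icc 1 N, RCLike.re (a n) := by
  have h : (N : 𝕜)⁻¹ = (((N : ℝ)⁻¹ : ℝ) : 𝕜) := by push_cast; rfl
  rw [mean, h, RCLike.re_ofReal_mul, map_sum]

theorem norm_mean_le (N : ℕ) (a : ℕ → 𝕜) :
    ‖mean N a‖ ≤ (N : ℝ)⁻¹ * ∑ n ∈ Finset.Icc 1 N, ‖a n‖ := by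
  rw [mean, norm_mul, norm_inv, RCLike.norm_natCast]
  gcongr
  exact norm_sum_le _ _

theorem norm_mean_le_one {N : ℕ} {a : ℕ → 𝕜} (ha : ∀ n, ‖a n‖ ≤ 1) : ‖mean N a‖ ≤ 1 := by
  refine (norm_mean_le N a).trans ?_
  calc (N : ℝ)⁻¹ * ∑ n ∈ Finset.Icc 1 N, ‖a n‖
      ≤ (N : ℝ)⁻¹ * ∑ n ∈ Finset.Icc 1 N, 1 := by gcongr with n _; exact ha n
    _ = (N : ℝ)⁻¹ * N := by simp
    _ ≤ 1 := inv_mul_le_one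

theorem mean_const {N : ℕ} (hN : 0 < N) (c : 𝕜) : mean N (fun _ => c) = c := by
  have : (N : 𝕜) ≠ 0 := by exact_mod_cast hN.ne'
  simp [mean, this]

theorem norm_sq_mean_le (N : ℕ) (a : ℕ → 𝕜) :
    ‖mean N a‖ ^ 2 ≤ (N : ℝ)⁻¹ * ∑ n ∈ Finset.Icc 1 N, ‖a n‖ ^ 2 := by
  rcases Nat.eq_zero_or_pos N with rfl | hN
  · simp [mean]
  have h1 : (∑ n ∈ Finset.Icc 1 N, ‖a n‖) ^ 2 ≤ N * ∑ n ∈ Finset.Icc 1 N, ‖a n‖ ^ 2 := by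
    simpa using sq_sum_le_card_mul_sum_sq (s := Finset.Icc 1 N) (f := fun n => ‖a n‖)
  calc ‖mean N a‖ ^ 2 ≤ ((N : ℝ)⁻¹ * ∑ n ∈ Finset.Icc 1 N, ‖a n‖) ^ 2 := by
        gcongr; exact norm_mean_le N a
    _ = ((N : ℝ)⁻¹) ^ 2 * (∑ n ∈ Finset.Icc 1 N, ‖a n‖) ^ 2 := mul_pow _ _ _
    _ ≤ ((N : ℝ)⁻¹) ^ 2 * (N * ∑ n ∈ Finset.Icc 1 N, ‖a n‖ ^ 2) := by gcongr
    _ = (N : ℝ)⁻¹ * ∑ n ∈ Finset.Icc 1 N, ‖a n‖ ^ 2 := by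
        have : (N : ℝ) ≠ 0 := by positivity
        field_simp

theorem norm_sq_sum_eq {κ : Type*} (s : Finset κ) (x : κ → 𝕜) :
    ‖∑ h ∈ s, x h‖ ^ 2 = ∑ h ∈ s, ∑ h' ∈ s, RCLike.re (x h * starRingEnd 𝕜 (x h')) := by
  have h := RCLike.mul_conj (∑ h ∈ s, x h)
  rw [map_sum, Finset.sum_mul_sum] at h
  have h2 := congrArg RCLike.re h
  simp only [map_sum] at h2
  rw [h2]
  norm_cast

theorem norm_mean_sub_mean_shift_le {a : ℕ → 𝕜} (ha : ∀ n, ‖a n‖ ≤ 1) (N h : ℕ) :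
    ‖mean N a - mean N fun n => a (n + h)‖ ≤ 2 * h / N := by
  have key : ∀ h, ‖∑ n ∈ Finset.Icc 1 N, a n - ∑ n ∈ Finset.Icc 1 N, a (n + h)‖ ≤ 2 * h := by
    intro h
    induction h with
    | zero => simp
    | succ h ih =>
      have hstep : ∑ n ∈ Finset.Icc 1 N, a (n + h) - ∑ n ∈ Finset.Icc 1 N, a (n + (h + 1)) =
          a (1 + h) - a (N + 1 + h) := by
        clear ih
        induction N with
        | zero => simp
        | succ N ih =>
          rw [Finset.sum_Icc_succ_top (by omega), Finset.sum_Icc_succ_top (by omega),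
            add_sub_add_comm, ih]
          rw [show N + 1 + (h + 1) = N + 1 + 1 + h by ring]
          ring
      calc ‖∑ n ∈ Finset.Icc 1 N, a n - ∑ n ∈ Finset.Icc 1 N, a (n + (h + 1))‖
          = ‖(∑ n ∈ Finset.Icc 1 N, a n - ∑ n ∈ Finset.Icc 1 N, a (n + h)) +
              (a (1 + h) - a (N + 1 + h))‖ := by rw [← hstep]; congr 1; ring
        _ ≤ 2 * h + (1 + 1) := (norm_add_le _ _).trans
            (add_le_add ih ((norm_sub_le _ _).trans (add_le_add (ha _) (ha _))))
        _ = 2 * ((h + 1 : ℕ) : ℝ) := by push_cast; ring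
  rw [mean, mean, ← mul_sub, norm_mul, norm_inv, RCLike.norm_natCast, div_eq_inv_mul]
  gcongr
  exact key h

/-- The van der Corput inequality for scalars, with the double sum over all ordered pairs of shifts,
including the diagonal. -/
theorem van_der_corput {a : ℕ → 𝕜} (ha : ∀ n, ‖a n‖ ≤ 1) (N : ℕ) {H : ℕ} (hH : 0 < H) :
    ‖mean N a‖ ^ 2 ≤ ((H : ℝ) ^ 2)⁻¹ * ∑ h ∈ Finset.Icc 1 H, ∑ h' ∈ Finset.Icc 1 H,
      RCLike.re (mean N fun n => a (n + h) * starRingEnd 𝕜 (a (n + h'))) + 4 * H / N := by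
  set b : ℕ → 𝕜 := fun n => mean H fun h => a (n + h) with hb
  have hb1 : ∀ n, ‖b n‖ ≤ 1 := fun n => norm_mean_le_one fun h => ha _
  have hdiff : ‖mean N a - mean N b‖ ≤ 2 * H / N := by
    have hswap : mean N b = mean H fun h => mean N fun n => a (n + h) := by
      simp only [hb, mean, Finset.mul_sum]
      rw [Finset.sum_comm]
      exact Finset.sum_congr rfl fun _ _ => Finset.sum_congr rfl fun _ _ => by ring
    have hsub : mean N a - mean N b = mean H fun h => mean N a - mean N fun n => a (n + h) := by
      rw [hswap]
      conv_lhs => rw [← mean_const hH (mean N a)]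
      simp only [mean, Finset.sum_sub_distrib, mul_sub]
    rw [hsub]
    refine (norm_mean_le _ _).trans ?_
    calc (H : ℝ)⁻¹ * ∑ h ∈ Finset.Icc 1 H, ‖mean N a - mean N fun n => a (n + h)‖
        ≤ (H : ℝ)⁻¹ * ∑ h ∈ Finset.Icc 1 H, 2 * (H : ℝ) / N := by
          gcongr with h hh
          refine (norm_mean_sub_mean_shift_le ha N h).trans ?_
          gcongr
          exact (Finset.mem_Icc.1 hh).2
      _ = 2 * H / N := by
          have : (H : ℝ) ≠ 0 := by positivity
          rw [Finset.sum_const, Nat.card_Icc, Nat.add_sub_cancel, nsmul_eq_mul]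
          field_simp
  have hsq : ‖mean N a‖ ^ 2 ≤ ‖mean N b‖ ^ 2 + 4 * H / N := by
    have h1 : ‖mean N a‖ ≤ ‖mean N b‖ + 2 * H / N := by
      have := norm_sub_norm_le (mean N a) (mean N b)
      linarith
    have h2 := norm_mean_le_one (N := N) ha
    have h3 := norm_mean_le_one (N := N) hb1
    have h4 : (0 : ℝ) ≤ 2 * H / N := by positivity
    have h5 : (4 : ℝ) * H / N = 2 * (2 * H / N) := by ring
    rw [h5]
    nlinarith [norm_nonneg (mean N a), norm_nonneg (mean N b)]
  refine hsq.trans (add_le_add ((norm_sq_mean_le N b).trans_eq ?_) le_rfl)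
  have hbn : ∀ n, ‖b n‖ ^ 2 = ((H : ℝ) ^ 2)⁻¹ * ∑ h ∈ Finset.Icc 1 H, ∑ h' ∈ Finset.Icc 1 H,
      RCLike.re (a (n + h) * starRingEnd 𝕜 (a (n + h'))) := by
    intro n
    simp only [hb, mean]
    rw [norm_mul, mul_pow, norm_sq_sum_eq, norm_inv, RCLike.norm_natCast, inv_pow]
  simp only [hbn, re_mean, Finset.mul_sum]
  rw [Finset.sum_comm]
  refine Finset.sum_congr rfl fun h _ => ?_
  rw [Finset.sum_comm]
  exact Finset.sum_congr rfl fun _ _ => Finset.sum_congr rfl fun _ _ => by ring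

theorem norm_prod_sub_prod_le {κ : Type*} (s : Finset κ) {x y : κ → 𝕜}
    (hx : ∀ i ∈ s, ‖x i‖ ≤ 1) (hy : ∀ i ∈ s, ‖y i‖ ≤ 1) :
    ‖∏ i ∈ s, x i - ∏ i ∈ s, y i‖ ≤ ∑ i ∈ s, ‖x i - y i‖ := by
  classical
  induction s using Finset.induction_on with
  | empty => simp
  | insert a s ha ih =>
    rw [Finset.prod_insert ha, Finset.prod_insert ha, Finset.sum_insert ha]
    have hx' : ‖∏ i ∈ s, x i‖ ≤ 1 := by
      rw [norm_prod]
      exact Finset.prod_le_one (fun _ _ => norm_nonneg _)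
        fun i hi => hx i (Finset.mem_insert_of_mem hi)
    have hya := hy a (Finset.mem_insert_self a s)
    have := ih (fun i hi => hx i (Finset.mem_insert_of_mem hi))
      fun i hi => hy i (Finset.mem_insert_of_mem hi)
    calc ‖x a * ∏ i ∈ s, x i - y a * ∏ i ∈ s, y i‖
        = ‖(x a - y a) * ∏ i ∈ s, x i + y a * (∏ i ∈ s, x i - ∏ i ∈ s, y i)‖ := by
          congr 1; ring
      _ ≤ ‖x a - y a‖ * ‖∏ i ∈ s, x i‖ + ‖y a‖ * ‖∏ i ∈ s, x i - ∏ i ∈ s, y i‖ :=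
          (norm_add_le _ _).trans (add_le_add (norm_mul_le _ _) (norm_mul_le _ _))
      _ ≤ ‖x a - y a‖ * 1 + 1 * ∑ i ∈ s, ‖x i - y i‖ := by gcongr
      _ = _ := by ring

end Mean

/-! ### Functions bounded by one -/

/-- `f` is strongly measurable and bounded by `1` everywhere (not just almost everywhere, so that
products along orbits are bounded pointwise). -/
structure UnitBounded {X 𝕜 : Type*} [MeasurableSpace X] [RCLike 𝕜] (f : X → 𝕜) : Prop where
  stronglyMeasurable : StronglyMeasurable f
  norm_le_one : ∀ x, ‖f x‖ ≤ 1

namespace UnitBounded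

variable {X 𝕜 : Type*} [MeasurableSpace X] [RCLike 𝕜] {μ : Measure X} [IsProbabilityMeasure μ]
  {f g : X → 𝕜} {T : X → X}

theorem integrable (hf : UnitBounded f) : Integrable f μ :=
  Integrable.of_bound hf.stronglyMeasurable.aestronglyMeasurable 1
    (Eventually.of_forall hf.norm_le_one)

theorem norm_integral_le_one (hf : UnitBounded f) : ‖∫ x, f x ∂μ‖ ≤ 1 := by
  have := norm_integral_le_of_norm_le_const (μ := μ) (Eventually.of_forall hf.norm_le_one)
  simpa using this

theorem comp_iterate (hf : UnitBounded f) (hT : Measurable T) (k : ℕ) :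
    UnitBounded fun x => f (T^[k] x) :=
  ⟨hf.stronglyMeasurable.comp_measurable (hT.iterate k), fun _ => hf.norm_le_one _⟩

theorem mul (hf : UnitBounded f) (hg : UnitBounded g) : UnitBounded fun x => f x * g x :=
  ⟨hf.stronglyMeasurable.mul hg.stronglyMeasurable, fun x => by
    rw [norm_mul]
    exact mul_le_one₀ (hf.norm_le_one x) (norm_nonneg _) (hg.norm_le_one x)⟩

theorem conj (hf : UnitBounded f) : UnitBounded fun x => starRingEnd 𝕜 (f x) :=
  ⟨RCLike.continuous_conj.comp_stronglyMeasurable hf.stronglyMeasurable, fun x => by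
    rw [RCLike.norm_conj]; exact hf.norm_le_one x⟩

theorem prod {ι : Type*} [Fintype ι] {f : ι → X → 𝕜} (hf : ∀ i, UnitBounded (f i)) :
    UnitBounded fun x => ∏ i, f i x :=
  ⟨Finset.stronglyMeasurable_fun_prod _ fun i _ => (hf i).stronglyMeasurable, fun x => by
    rw [norm_prod]
    exact Finset.prod_le_one (fun _ _ => norm_nonneg _) fun i _ => (hf i).norm_le_one x⟩

theorem mean {f : ℕ → X → 𝕜} (hf : ∀ n, UnitBounded (f n)) (N : ℕ) :
    UnitBounded fun x => mean N fun n => f n x :=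
  ⟨(Finset.stronglyMeasurable_fun_sum _ fun n _ => (hf n).stronglyMeasurable).const_mul _,
    fun x => norm_mean_le_one fun n => (hf n).norm_le_one x⟩

theorem integral_mean {f : ℕ → X → 𝕜} (hf : ∀ n, UnitBounded (f n)) (N : ℕ) :
    ∫ x, _root_.mean N (fun n => f n x) ∂μ = _root_.mean N fun n => ∫ x, f n x ∂μ := by
  simp only [_root_.mean]
  rw [integral_const_mul, integral_finsetSum _ fun n _ => (hf n).integrable]

theorem integrable_norm_sub_sq (hf : UnitBounded f) (c : 𝕜) :
    Integrable (fun x => ‖f x - c‖ ^ 2) μ := by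
  refine Integrable.of_bound ((hf.stronglyMeasurable.sub
    stronglyMeasurable_const).norm.pow 2).aestronglyMeasurable ((1 + ‖c‖) ^ 2)
    (Eventually.of_forall fun x => ?_)
  rw [Real.norm_of_nonneg (sq_nonneg _)]
  gcongr
  exact (norm_sub_le _ _).trans (by gcongr; exact hf.norm_le_one x)

end UnitBounded

section Integral

variable {X 𝕜 : Type*} [MeasurableSpace X] [RCLike 𝕜] {μ : Measure X}

theorem integral_comp_iterate {E : Type*} [NormedAddCommGroup E] [NormedSpace ℝ E]
    {T : X → X} (hT : MeasurePreserving T μ μ) {f : X → E}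
    (hf : StronglyMeasurable f) (k : ℕ) : ∫ x, f (T^[k] x) ∂μ = ∫ x, f x ∂μ := by
  have h := hT.iterate k
  conv_rhs => rw [← h.map_eq]
  rw [integral_map h.measurable.aemeasurable hf.aestronglyMeasurable]

theorem norm_correlation_comp_iterate {T : X → X} (hT : MeasurePreserving T μ μ) {f : X → 𝕜}
    (hf : UnitBounded f) (j k : ℕ) :
    ‖∫ x, f (T^[j] x) * starRingEnd 𝕜 (f (T^[k] x)) ∂μ -
      (∫ x, f x ∂μ) * starRingEnd 𝕜 (∫ x, f x ∂μ)‖ =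
    ‖∫ x, f (T^[Nat.dist j k] x) * starRingEnd 𝕜 (f x) ∂μ -
      (∫ x, f x ∂μ) * starRingEnd 𝕜 (∫ x, f x ∂μ)‖ := by
  have key : ∀ m l, ∫ x, f (T^[m + l] x) * starRingEnd 𝕜 (f (T^[l] x)) ∂μ =
      ∫ x, f (T^[m] x) * starRingEnd 𝕜 (f x) ∂μ := by
    intro m l
    have := integral_comp_iterate hT
      ((hf.comp_iterate hT.measurable m).mul hf.conj).stronglyMeasurable l
    simpa only [Function.iterate_add_apply] using this
  rcases le_total k j with h | h
  · obtain ⟨m, rfl⟩ := Nat.exists_eq_add_of_le' h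
    rw [key, show Nat.dist (m + k) k = m by simp [Nat.dist]]
  · obtain ⟨m, rfl⟩ := Nat.exists_eq_add_of_le' h
    rw [show Nat.dist j (m + j) = m by simp [Nat.dist], ← key m j,
      ← RCLike.norm_conj, map_sub, map_mul, RCLike.conj_conj, ← integral_conj]
    simp only [map_mul, RCLike.conj_conj]
    congr 2
    · exact integral_congr_ae (Eventually.of_forall fun x => mul_comm _ _)
    · exact mul_comm _ _

variable [IsProbabilityMeasure μ]

theorem integral_norm_sub_sq {F : X → 𝕜} (hF : Integrable F μ)
    (hF2 : Integrable (fun x => ‖F x‖ ^ 2) μ) (c : 𝕜) :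
    ∫ x, ‖F x - c‖ ^ 2 ∂μ =
      ∫ x, ‖F x‖ ^ 2 ∂μ - 2 * RCLike.re (starRingEnd 𝕜 c * ∫ x, F x ∂μ) + ‖c‖ ^ 2 := by
  have hpt : ∀ x, ‖F x - c‖ ^ 2 =
      ‖F x‖ ^ 2 - 2 * RCLike.re (starRingEnd 𝕜 c * F x) + ‖c‖ ^ 2 := by
    intro x
    have := norm_sub_sq (𝕜 := 𝕜) (F x) c
    rw [this, ← inner_conj_symm, RCLike.conj_re, RCLike.inner_apply]
    rw [mul_comm (F x)]
  have hint : Integrable (fun x => starRingEnd 𝕜 c * F x) μ := hF.const_mul _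
  have hre : ∫ x, RCLike.re (starRingEnd 𝕜 c * F x) ∂μ =
      RCLike.re (starRingEnd 𝕜 c * ∫ x, F x ∂μ) := by
    rw [integral_re hint, integral_const_mul]
  have hint' : Integrable (fun x => 2 * RCLike.re (starRingEnd 𝕜 c * F x)) μ :=
    hint.re.const_mul 2
  have hsub : Integrable (fun x => ‖F x‖ ^ 2 - 2 * RCLike.re (starRingEnd 𝕜 c * F x)) μ :=
    hF2.sub hint'
  simp only [hpt]
  rw [integral_add hsub (integrable_const _), integral_sub hF2 hint', integral_const_mul, hre]
  simp

theorem norm_sq_integral_le {F : X → 𝕜} (hF : Integrable F μ)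
    (hF2 : Integrable (fun x => ‖F x‖ ^ 2) μ) : ‖∫ x, F x ∂μ‖ ^ 2 ≤ ∫ x, ‖F x‖ ^ 2 ∂μ := by
  have h := integral_norm_sub_sq hF hF2 (∫ x, F x ∂μ)
  have h0 : 0 ≤ ∫ x, ‖F x - ∫ x, F x ∂μ‖ ^ 2 ∂μ := integral_nonneg fun x => sq_nonneg _
  rw [RCLike.conj_mul] at h
  norm_cast at h
  linarith

end Integral

/-! ### Weak mixing for bounded functions -/

namespace IsWeaklyMixing

variable {X 𝕜 : Type*} [MeasurableSpace X] [RCLike 𝕜] {μ : Measure X} [IsProbabilityMeasure μ]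
  {T : X → X}

theorem nullInMean_simpleFunc (hT : IsWeaklyMixing T μ) (s : SimpleFunc X 𝕜) :
    NullInMean fun k => ‖∫ x, s (T^[k] x) * starRingEnd 𝕜 (s x) ∂μ -
      (∫ x, s x ∂μ) * starRingEnd 𝕜 (∫ x, s x ∂μ)‖ := by
  have hA : ∀ y, MeasurableSet (s ⁻¹' {y}) := fun y => s.measurableSet_preimage _
  have hs : ∀ x, s x = ∑ y ∈ s.range, y * (s ⁻¹' {y}).indicator (fun _ => (1 : 𝕜)) x := by
    intro x
    rw [Finset.sum_eq_single (s x)]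
    · simp
    · intro y _ hy
      rw [Set.indicator_of_notMem (fun h => hy h.symm), mul_zero]
    · intro h; exact absurd (s.mem_range_self x) h
  have hint : ∫ x, s x ∂μ = ∑ y ∈ s.range, y * (μ.real (s ⁻¹' {y}) : 𝕜) := by
    simp_rw [fun x => hs x]
    rw [integral_finsetSum _ fun y _ => ((integrable_const (1 : 𝕜)).indicator (hA y)).const_mul y]
    refine Finset.sum_congr rfl fun y _ => ?_
    rw [integral_const_mul, integral_indicator_const _ (hA y), RCLike.real_smul_eq_coe_mul, mul_one]
  have hint2 : ∀ k, ∫ x, s (T^[k] x) * starRingEnd 𝕜 (s x) ∂μ = ∑ y ∈ s.range, ∑ z ∈ s.range,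
      y * starRingEnd 𝕜 z * (μ.real (s ⁻¹' {z} ∩ T^[k] ⁻¹' (s ⁻¹' {y})) : 𝕜) := by
    intro k
    have hB : ∀ y z, MeasurableSet (s ⁻¹' {z} ∩ T^[k] ⁻¹' (s ⁻¹' {y})) := fun y z =>
      (hA z).inter ((hT.measurePreserving.measurable.iterate k) (hA y))
    have hpt : ∀ x, s (T^[k] x) * starRingEnd 𝕜 (s x) = ∑ y ∈ s.range, ∑ z ∈ s.range,
        y * starRingEnd 𝕜 z *
          (s ⁻¹' {z} ∩ T^[k] ⁻¹' (s ⁻¹' {y})).indicator (fun _ => (1 : 𝕜)) x := by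
      intro x
      rw [hs (T^[k] x), hs x, map_sum, Finset.sum_mul_sum]
      refine Finset.sum_congr rfl fun y _ => Finset.sum_congr rfl fun z _ => ?_
      rw [map_mul]
      by_cases h1 : s (T^[k] x) = y <;> by_cases h2 : s x = z <;> simp [Set.indicator, h1, h2]
    simp_rw [hpt]
    rw [integral_finsetSum _ fun y _ => integrable_finsetSum _ fun z _ =>
      ((integrable_const (1 : 𝕜)).indicator (hB y z)).const_mul _]
    refine Finset.sum_congr rfl fun y _ => ?_
    rw [integral_finsetSum _ fun z _ => ((integrable_const (1 : 𝕜)).indicator (hB y z)).const_mul _]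
    refine Finset.sum_congr rfl fun z _ => ?_
    rw [integral_const_mul, integral_indicator_const _ (hB y z), RCLike.real_smul_eq_coe_mul,
      mul_one]
  have hnull : NullInMean fun k => ∑ y ∈ s.range, ∑ z ∈ s.range, ‖y * starRingEnd 𝕜 z‖ *
      |μ.real (s ⁻¹' {z} ∩ T^[k] ⁻¹' (s ⁻¹' {y})) -
        μ.real (s ⁻¹' {z}) * μ.real (s ⁻¹' {y})| :=
    NullInMean.sum fun y _ => NullInMean.sum fun z _ =>
      NullInMean.const_mul (hT.tendsto_average _ _ (hA z) (hA y)) _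
  refine NullInMean.of_le (fun k => norm_nonneg _) fun ε hε => ⟨_, hnull, fun k => ?_⟩
  refine le_trans ?_ (le_add_of_nonneg_right hε.le)
  rw [hint2, hint, map_sum, Finset.sum_mul_sum, ← Finset.sum_sub_distrib]
  refine (norm_sum_le _ _).trans (Finset.sum_le_sum fun y _ => ?_)
  rw [← Finset.sum_sub_distrib]
  refine (norm_sum_le _ _).trans (Finset.sum_le_sum fun z _ => ?_)
  rw [← RCLike.norm_ofReal (K := 𝕜), ← norm_mul]
  apply le_of_eq
  congr 1
  rw [map_mul, RCLike.conj_ofReal]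
  push_cast
  ring

theorem nullInMean_correlation (hT : IsWeaklyMixing T μ) {f : X → 𝕜} (hf : UnitBounded f) :
    NullInMean fun k => ‖∫ x, f (T^[k] x) * starRingEnd 𝕜 (f x) ∂μ -
      (∫ x, f x ∂μ) * starRingEnd 𝕜 (∫ x, f x ∂μ)‖ := by
  refine NullInMean.of_le (fun k => norm_nonneg _) fun ε hε => ?_
  set s : ℕ → SimpleFunc X 𝕜 := fun n => hf.stronglyMeasurable.approxBounded 1 n with hs
  have hs1 : ∀ n, UnitBounded (s n) := fun n =>
    ⟨(s n).stronglyMeasurable, hf.stronglyMeasurable.norm_approxBounded_le zero_le_one n⟩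
  have hlim : Tendsto (fun n => ∫ x, ‖f x - s n x‖ ∂μ) atTop (𝓝 0) := by
    have := tendsto_integral_of_dominated_convergence (μ := μ) (F := fun n x => ‖f x - s n x‖)
      (f := fun _ => (0 : ℝ)) (fun _ => 2)
      (fun n => (hf.stronglyMeasurable.sub (hs1 n).stronglyMeasurable).norm.aestronglyMeasurable)
      (integrable_const _) (fun n => Eventually.of_forall fun x => ?_)
      (Eventually.of_forall fun x => ?_)
    · simpa using this
    · rw [norm_norm]
      exact (norm_sub_le _ _).trans
        ((add_le_add (hf.norm_le_one x) ((hs1 n).norm_le_one x)).trans_eq one_add_one_eq_two)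
    · have := (tendsto_const_nhds (x := f x)).sub
        (hf.stronglyMeasurable.tendsto_approxBounded_of_norm_le (hf.norm_le_one x))
      simpa using this.norm
  obtain ⟨n, hn⟩ := (hlim.eventually_le_const (show 0 < ε / 4 by positivity)).exists
  refine ⟨_, hT.nullInMean_simpleFunc (s n), fun k => ?_⟩
  have hg := hs1 n
  set g : X → 𝕜 := ⇑(s n)
  have hTm := hT.measurePreserving.measurable
  have hd : Integrable (fun x => ‖f x - g x‖) μ := (hf.integrable.sub hg.integrable).norm
  have e1 : ‖∫ x, f x ∂μ - ∫ x, g x ∂μ‖ ≤ ε / 4 := by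
    rw [← integral_sub hf.integrable hg.integrable]
    exact (norm_integral_le_integral_norm _).trans hn
  have e2 : ‖∫ x, f (T^[k] x) * starRingEnd 𝕜 (f x) ∂μ -
      ∫ x, g (T^[k] x) * starRingEnd 𝕜 (f x) ∂μ‖ ≤ ε / 4 := by
    rw [← integral_sub ((hf.comp_iterate hTm k).mul hf.conj).integrable
      ((hg.comp_iterate hTm k).mul hf.conj).integrable]
    have h0 := integral_comp_iterate hT.measurePreserving
      (hf.stronglyMeasurable.sub hg.stronglyMeasurable).norm k
    simp only [Pi.sub_apply] at h0
    refine (norm_integral_le_of_norm_le ?_ (Eventually.of_forall fun x => ?_)).trans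
      (h0.trans_le hn)
    · exact ((hf.comp_iterate hTm k).integrable.sub (hg.comp_iterate hTm k).integrable).norm
    · rw [← sub_mul, norm_mul, RCLike.norm_conj]
      exact mul_le_of_le_one_right (norm_nonneg _) (hf.norm_le_one x)
  have e3 : ‖∫ x, g (T^[k] x) * starRingEnd 𝕜 (f x) ∂μ -
      ∫ x, g (T^[k] x) * starRingEnd 𝕜 (g x) ∂μ‖ ≤ ε / 4 := by
    rw [← integral_sub ((hg.comp_iterate hTm k).mul hf.conj).integrable
      ((hg.comp_iterate hTm k).mul hg.conj).integrable]
    refine (norm_integral_le_of_norm_le hd (Eventually.of_forall fun x => ?_)).trans hn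
    rw [← mul_sub, ← map_sub, norm_mul, RCLike.norm_conj]
    exact mul_le_of_le_one_left (norm_nonneg _) (hg.norm_le_one _)
  have e4 : ‖(∫ x, g x ∂μ) * starRingEnd 𝕜 (∫ x, g x ∂μ) -
      (∫ x, f x ∂μ) * starRingEnd 𝕜 (∫ x, f x ∂μ)‖ ≤ ε / 4 + ε / 4 := by
    have hfi := hf.norm_integral_le_one (μ := μ)
    have hgi := hg.norm_integral_le_one (μ := μ)
    generalize (∫ x, f x ∂μ) = α at *
    generalize (∫ x, g x ∂μ) = β at *
    calc ‖β * starRingEnd 𝕜 β - α * starRingEnd 𝕜 α‖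
        = ‖-(α - β) * starRingEnd 𝕜 β + α * starRingEnd 𝕜 (-(α - β))‖ := by
          congr 1; rw [map_neg, map_sub]; ring
      _ ≤ ‖α - β‖ * ‖β‖ + ‖α‖ * ‖α - β‖ := by
          refine (norm_add_le _ _).trans_eq ?_
          rw [norm_mul, norm_mul, RCLike.norm_conj, RCLike.norm_conj, norm_neg]
      _ ≤ ε / 4 * 1 + 1 * (ε / 4) := by gcongr
      _ = ε / 4 + ε / 4 := by ring
  calc _ = ‖(∫ x, g (T^[k] x) * starRingEnd 𝕜 (g x) ∂μ -
          (∫ x, g x ∂μ) * starRingEnd 𝕜 (∫ x, g x ∂μ)) +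
        ((∫ x, f (T^[k] x) * starRingEnd 𝕜 (f x) ∂μ -
          ∫ x, g (T^[k] x) * starRingEnd 𝕜 (f x) ∂μ) +
        (∫ x, g (T^[k] x) * starRingEnd 𝕜 (f x) ∂μ -
          ∫ x, g (T^[k] x) * starRingEnd 𝕜 (g x) ∂μ)) +
        ((∫ x, g x ∂μ) * starRingEnd 𝕜 (∫ x, g x ∂μ) -
          (∫ x, f x ∂μ) * starRingEnd 𝕜 (∫ x, f x ∂μ))‖ := by congr 1; ring
    _ ≤ _ := by
      refine (norm_add₃_le).trans ?_
      have := norm_add_le_of_le e2 e3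
      linarith

end IsWeaklyMixing

/-! ### Averages along polynomial orbits -/

section Orbit

variable {X 𝕜 : Type*} [RCLike 𝕜] {ι : Type} [Fintype ι]

/-- The product of the `T ^ (p i n) (f i)`. The exponent is truncated to a natural number, so this
is meaningful only where `0 ≤ p i n`. -/
def orbitProduct (T : X → X) (p : ι → Polynomial ℤ) (f : ι → X → 𝕜) (n : ℕ) (x : X) : 𝕜 :=
  ∏ i, f i (T^[((p i).eval (n : ℤ)).toNat] x)

/-- All members of `p` are non-negative at `1, …, N`. -/
def NonnegUpTo (p : ι → Polynomial ℤ) (N : ℕ) : Prop :=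
  ∀ i, ∀ n ∈ Finset.Icc 1 N, 0 ≤ (p i).eval (n : ℤ)

/-- Adding a large constant makes the exponents on a finite range non-negative. -/
theorem exists_shift_nonneg (p : ι → Polynomial ℤ) (N : ℕ) :
    ∃ K : ℕ, NonnegUpTo (fun i => p i + Polynomial.C (K : ℤ)) N := by
  refine ⟨∑ i, ∑ n ∈ Finset.Icc 1 N, ((p i).eval (n : ℤ)).natAbs, fun i n hn => ?_⟩
  have h1 : ((p i).eval (n : ℤ)).natAbs ≤ ∑ n ∈ Finset.Icc 1 N, ((p i).eval (n : ℤ)).natAbs :=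
    Finset.single_le_sum (f := fun n : ℕ => ((p i).eval (n : ℤ)).natAbs)
      (fun _ _ => Nat.zero_le _) hn
  have h2 : ∑ n ∈ Finset.Icc 1 N, ((p i).eval (n : ℤ)).natAbs ≤
      ∑ i, ∑ n ∈ Finset.Icc 1 N, ((p i).eval (n : ℤ)).natAbs :=
    Finset.single_le_sum (f := fun i => ∑ n ∈ Finset.Icc 1 N, ((p i).eval (n : ℤ)).natAbs)
      (fun _ _ => Nat.zero_le _) (Finset.mem_univ i)
  rw [Polynomial.eval_add, Polynomial.eval_C]
  omega

theorem orbitProduct_iterate (T : X → X) {p : ι → Polynomial ℤ} (f : ι → X → 𝕜) {n : ℕ}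
    (hn : ∀ i, 0 ≤ (p i).eval (n : ℤ)) (K : ℕ) (x : X) :
    orbitProduct T p f n (T^[K] x) =
      orbitProduct T (fun i => p i + Polynomial.C (K : ℤ)) f n x := by
  refine Finset.prod_congr rfl fun i _ => ?_
  have := hn i
  rw [← Function.iterate_add_apply, Polynomial.eval_add, Polynomial.eval_C,
    Int.toNat_add this (Int.natCast_nonneg K), Int.toNat_natCast]

theorem mean_congr {N : ℕ} {a b : ℕ → 𝕜} (h : ∀ n ∈ Finset.Icc 1 N, a n = b n) :
    mean N a = mean N b := by
  rw [mean, mean, Finset.sum_congr rfl h]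

variable [MeasurableSpace X]

variable (𝕜) in
/-- The averages along systems with leading data `D` converge in `L²` to the product of the
integrals, uniformly over all systems that are non-negative on the range of averaging. -/
def UniformlyConverges (T : X → X) (μ : Measure X) (D : LeadingData ι) : Prop :=
  ∀ f : ι → X → 𝕜, (∀ i, UnitBounded (f i)) → ∀ ε : ℝ, 0 < ε → ∃ N₀ : ℕ, ∀ N : ℕ, N₀ ≤ N →
    ∀ p, D.Admits p → NonnegUpTo p N →
      ∫ x, ‖mean N (fun n => orbitProduct T p f n x) - ∏ i, ∫ y, f i y ∂μ‖ ^ 2 ∂μ ≤ ε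

theorem UnitBounded.orbitProduct {T : X → X} (hT : Measurable T) {f : ι → X → 𝕜}
    (hf : ∀ i, UnitBounded (f i)) (p : ι → Polynomial ℤ) (n : ℕ) :
    UnitBounded (orbitProduct T p f n) :=
  UnitBounded.prod fun i => (hf i).comp_iterate hT _

/-- Adding `K` to all exponents composes the average with `T ^ K`, which does not change its `L²`
distance to a constant. -/
theorem integral_norm_sq_mean_shift {μ : Measure X} {T : X → X} (hT : MeasurePreserving T μ μ)
    {p : ι → Polynomial ℤ} {f : ι → X → 𝕜} (hf : ∀ i, UnitBounded (f i)) {N : ℕ}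
    (hp : NonnegUpTo p N) (K : ℕ) (c : 𝕜) :
    ∫ x, ‖mean N (fun n => orbitProduct T (fun i => p i + Polynomial.C (K : ℤ)) f n x) - c‖ ^ 2 ∂μ =
      ∫ x, ‖mean N (fun n => orbitProduct T p f n x) - c‖ ^ 2 ∂μ := by
  have hm := ((UnitBounded.mean (UnitBounded.orbitProduct hT.measurable hf p)
    N).stronglyMeasurable.sub (stronglyMeasurable_const (b := c))).norm.pow 2
  have h := integral_comp_iterate hT hm K
  simp only [Pi.pow_apply, Pi.sub_apply] at h
  rw [← h]
  refine integral_congr_ae (Eventually.of_forall fun x => ?_)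
  beta_reduce
  rw [mean_congr fun n hn => orbitProduct_iterate T f (fun i => hp i n hn) K x]

end Orbit

/-! ### Correlations of polynomial orbits -/

section Correlation

variable {X 𝕜 : Type*} [MeasurableSpace X] [RCLike 𝕜] {μ : Measure X} [IsProbabilityMeasure μ]
  {T : X → X}

theorem norm_sq_integral_mul_sub_le {G A : X → 𝕜} (hG : UnitBounded G) (hA : UnitBounded A)
    (c : 𝕜) : ‖∫ x, G x * (A x - c) ∂μ‖ ^ 2 ≤ ∫ x, ‖A x - c‖ ^ 2 ∂μ := by
  have hm : StronglyMeasurable fun x => G x * (A x - c) :=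
    hG.stronglyMeasurable.mul (hA.stronglyMeasurable.sub stronglyMeasurable_const)
  have hle : ∀ x, ‖G x * (A x - c)‖ ≤ ‖A x - c‖ := fun x => by
    rw [norm_mul]
    exact mul_le_of_le_one_left (norm_nonneg _) (hG.norm_le_one x)
  have hle2 : ∀ x, ‖G x * (A x - c)‖ ^ 2 ≤ ‖A x - c‖ ^ 2 := fun x => by
    gcongr; exact hle x
  have hi2 : Integrable (fun x => ‖G x * (A x - c)‖ ^ 2) μ :=
    (hA.integrable_norm_sub_sq c).mono' (hm.norm.pow 2).aestronglyMeasurable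
      (Eventually.of_forall fun x => by
        rw [Real.norm_of_nonneg (sq_nonneg _)]; exact hle2 x)
  have hi : Integrable (fun x => G x * (A x - c)) μ :=
    (hA.integrable.sub (integrable_const c)).mono hm.aestronglyMeasurable
      (Eventually.of_forall hle)
  exact (norm_sq_integral_le hi hi2).trans
    (integral_mono hi2 (hA.integrable_norm_sub_sq c) hle2)

/-- Convergence in `L²` for the differences `q j - q j₀` implies convergence of correlations along
`q`, since `T ^ (q j₀ n)` can be factored out of the integrals. -/
theorem UniformlyConverges.exists_norm_mean_integral_sub_le (hT : MeasurePreserving T μ μ)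
    {J : Type} [Fintype J] [DecidableEq J] {j₀ : J} {D : LeadingData {j // j ≠ j₀}}
    (hD : UniformlyConverges 𝕜 T μ D) {g : J → X → 𝕜} (hg : ∀ j, UnitBounded (g j))
    {ε : ℝ} (hε : 0 < ε) :
    ∃ N₀ : ℕ, ∀ N : ℕ, N₀ ≤ N → ∀ q : J → Polynomial ℤ,
      D.Admits (fun j => q j - q j₀) → NonnegUpTo q N →
        ‖mean N (fun n => ∫ x, orbitProduct T q g n x ∂μ) - ∏ j, ∫ x, g j x ∂μ‖ ≤ ε := by
  have hg' : ∀ j : {j // j ≠ j₀}, UnitBounded (g j) := fun j => hg j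
  obtain ⟨N₀, hN₀⟩ := hD (fun j => g j) hg' (ε ^ 2) (by positivity)
  refine ⟨N₀, fun N hN q hq hnn => ?_⟩
  obtain ⟨K, hK⟩ := exists_shift_nonneg (fun j : {j // j ≠ j₀} => q j - q j₀) N
  set q' : {j // j ≠ j₀} → Polynomial ℤ := fun j => q j - q j₀ + Polynomial.C (K : ℤ) with hq'
  set G : X → 𝕜 := fun x => g j₀ (T^[K] x) with hG
  have hGb : UnitBounded G := (hg j₀).comp_iterate hT.measurable K
  have hub := UnitBounded.orbitProduct hT.measurable hg' q'
  have hAb := UnitBounded.mean hub N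
  -- Translating by `T ^ K` and then factoring out `T ^ (q j₀ n)` leaves non-negative exponents.
  have hterm : ∀ n ∈ Finset.Icc 1 N, ∫ x, orbitProduct T q g n x ∂μ =
      ∫ x, G x * orbitProduct T q' (fun j : {j // j ≠ j₀} => g j) n x ∂μ := by
    intro n hn
    rw [← integral_comp_iterate hT
        (UnitBounded.orbitProduct hT.measurable hg q n).stronglyMeasurable K,
      ← integral_comp_iterate hT (hGb.mul (hub n)).stronglyMeasurable
        (((q j₀).eval (n : ℤ)).toNat)]
    refine integral_congr_ae (Eventually.of_forall fun x => ?_)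
    have h0 := hnn j₀ n hn
    simp only [orbitProduct, hG]
    rw [Fintype.prod_eq_mul_prod_subtype_ne _ j₀, ← Function.iterate_add_apply,
      ← Function.iterate_add_apply, add_comm]
    congr 1
    refine Finset.prod_congr rfl fun j _ => ?_
    have h1 := hnn j n hn
    have h2 := hK j n hn
    rw [← Function.iterate_add_apply, ← Function.iterate_add_apply]
    simp only [hq', Polynomial.eval_add, Polynomial.eval_sub, Polynomial.eval_C] at h2 ⊢
    congr 2
    omega
  have hmean : mean N (fun n => ∫ x, orbitProduct T q g n x ∂μ) =
      ∫ x, G x * mean N (fun n => orbitProduct T q' (fun j : {j // j ≠ j₀} => g j) n x) ∂μ := by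
    rw [mean_congr hterm, ← UnitBounded.integral_mean fun n => hGb.mul (hub n)]
    refine integral_congr_ae (Eventually.of_forall fun x => ?_)
    simp only [mean, ← Finset.mul_sum]
    ring
  have hprod : ∏ j, ∫ x, g j x ∂μ =
      ∫ x, G x * ∏ j : {j // j ≠ j₀}, ∫ y, g j y ∂μ ∂μ := by
    rw [integral_mul_const, hG, integral_comp_iterate hT (hg j₀).stronglyMeasurable,
      Fintype.prod_eq_mul_prod_subtype_ne _ j₀]
  rw [hmean, hprod, ← integral_sub (hGb.mul hAb).integrable (hGb.integrable.mul_const _)]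
  simp only [← mul_sub]
  refine (pow_le_pow_iff_left₀ (norm_nonneg _) hε.le two_ne_zero).1 ?_
  exact (norm_sq_integral_mul_sub_le hGb hAb _).trans (hN₀ N hN q' (hq.add_C K) hK)

end Correlation

/-! ### Correlations in the van der Corput inequality -/

section Step

variable {X 𝕜 : Type*} [MeasurableSpace X] [RCLike 𝕜] {μ : Measure X} [IsProbabilityMeasure μ]
  {T : X → X} {ι : Type} [Fintype ι]

variable (𝕜) in
/-- The induction hypothesis: uniform convergence for all leading data of smaller weight than `D`
and degrees at most `m`. -/
def ConvergesBelow (T : X → X) (μ : Measure X) (m : ℕ) (D : LeadingData ι) : Prop :=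
  ∀ (κ : Type) [Fintype κ] (D' : LeadingData κ), (∀ j, D'.deg j ≤ m) →
    LeadingData.WeightLT m (D'.weight m) (D.weight m) → UniformlyConverges 𝕜 T μ D'

/-- Correlations along a system of shifts of `p` converge, provided the pairwise differences of the
shifts have leading terms that do not depend on `p`. -/
theorem ConvergesBelow.exists_norm_mean_integral_sub_le (hT : MeasurePreserving T μ μ)
    {D : LeadingData ι} {m : ℕ} (hm : ∀ i, D.deg i ≤ m) (hD : ConvergesBelow 𝕜 T μ m D)
    {J : Type} [Fintype J] {π : J → ι} (hπ : Function.Surjective π) {s : J → ℤ} {j₀ : J}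
    (hj₀ : ∀ i, D.deg (π j₀) ≤ D.deg i)
    (hdiff : ∀ j j', j ≠ j' → ∃ (e : ℕ) (b : ℤ), ∀ p, D.Admits p →
      LeadsWith (Polynomial.taylor (s j) (p (π j)) - Polynomial.taylor (s j') (p (π j'))) e b)
    {g : J → X → 𝕜} (hg : ∀ j, UnitBounded (g j)) {ε : ℝ} (hε : 0 < ε) :
    ∃ N₀ : ℕ, ∀ N : ℕ, N₀ ≤ N → ∀ p, D.Admits p →
      NonnegUpTo (fun j => Polynomial.taylor (s j) (p (π j))) N →
        ‖mean N (fun n => ∫ x,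
          orbitProduct T (fun j => Polynomial.taylor (s j) (p (π j))) g n x ∂μ) -
            ∏ j, ∫ x, g j x ∂μ‖ ≤ ε := by
  classical
  by_cases hex : ∃ p, D.Admits p
  · obtain ⟨p₀, hp₀⟩ := hex
    choose! e b heb using hdiff
    set D' : LeadingData {j // j ≠ j₀} :=
      ⟨fun j => e j j₀, fun j => b j j₀, fun j j' => e j j', fun j j' => b j j'⟩ with hD'def
    have hadm : ∀ p, D.Admits p → D'.Admits fun j =>
        Polynomial.taylor (s j) (p (π j)) - Polynomial.taylor (s j₀) (p (π j₀)) := fun p hp =>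
      { leadsWith := fun j => heb j j₀ j.2 p hp
        leadsWith_sub := fun j j' hjj' => by
          rw [sub_sub_sub_cancel_right]
          exact heb j j' (fun h => hjj' (Subtype.ext h)) p hp }
    obtain ⟨hm', hw⟩ := LeadingData.weightLT_of_differences hp₀ hm hπ s j₀ hj₀ (hadm p₀ hp₀)
    obtain ⟨N₀, hN₀⟩ := (hD _ D' hm' hw).exists_norm_mean_integral_sub_le hT hg hε
    exact ⟨N₀, fun N hN p hp hnn => hN₀ N hN _ (hadm p hp) hnn⟩
  · exact ⟨0, fun N _ p hp => absurd ⟨p, hp⟩ hex⟩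

theorem LeadsWith.eval_add_of_deg_one {P : Polynomial ℤ} {c : ℤ} (h : LeadsWith P 1 c) (x y : ℤ) :
    P.eval (x + y) = P.eval x + c * y := by
  rw [Polynomial.eq_X_add_C_of_natDegree_le_one h.natDegree_le, h.coeff_eq]
  simp
  ring

/-- The one of `h`, `h'` for which `c * s` is smaller. For a linear polynomial `P` with leading
coefficient `c`, both `P (n + h)` and `P (n + h')` are then at least `P (n + s)`. -/
def alignedShift (c : ℤ) (h h' : ℕ) : ℕ := if 0 ≤ c then min h h' else max h h'

theorem alignedShift_eq_or (c : ℤ) (h h' : ℕ) :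
    alignedShift c h h' = h ∨ alignedShift c h h' = h' := by
  unfold alignedShift
  split_ifs <;> omega

theorem mul_sub_alignedShift_nonneg (c : ℤ) (h h' : ℕ) :
    0 ≤ c * (h - alignedShift c h h') ∧ 0 ≤ c * (h' - alignedShift c h h') := by
  unfold alignedShift
  split_ifs with hc
  · constructor <;> exact mul_nonneg hc (by push_cast; omega)
  · constructor <;> exact mul_nonneg_of_nonpos_of_nonpos (by omega) (by push_cast; omega)

theorem natCast_dist (a b : ℕ) : (Nat.dist a b : ℤ) = |(a : ℤ) - b| := by
  unfold Nat.dist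
  rcases abs_cases ((a : ℤ) - b) with h | h <;> omega

/-- The exponents that remain after the common factor `T ^ P (n + s)` is removed have distance
`|c| |h - h'|`. -/
theorem dist_toNat_mul_sub_alignedShift (c : ℤ) (h h' : ℕ) :
    Nat.dist (c * (h - alignedShift c h h')).toNat (c * (h' - alignedShift c h h')).toNat =
      c.natAbs * Nat.dist h h' := by
  obtain ⟨h1, h2⟩ := mul_sub_alignedShift_nonneg c h h'
  zify
  rw [natCast_dist, natCast_dist, Int.toNat_of_nonneg h1, Int.toNat_of_nonneg h2, ← abs_mul]
  congr 1
  ring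

theorem Fintype.prod_subtype_eq_prod_ite {κ M : Type*} [Fintype κ] [CommMonoid M] (P : κ → Prop)
    [DecidablePred P] (F : κ → M) :
    ∏ i : {i // P i}, F i = ∏ i, if P i then F i else 1 := by
  rw [← Finset.prod_filter]
  exact (Finset.prod_subtype _ (by simp) F).symm

/-- The correlations of the products at `n + h` and at `n + h'` have means close to `|∏ i, ∫ f i|²`,
up to a correlation of `f i` with its iterate for each linear member of the system. -/
theorem exists_re_mean_integral_mul_conj_le (hT : MeasurePreserving T μ μ)
    {D : LeadingData ι} {m : ℕ} (hm : ∀ i, D.deg i ≤ m) (hD : ConvergesBelow 𝕜 T μ m D)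
    [Nonempty ι] {f : ι → X → 𝕜} (hf : ∀ i, UnitBounded (f i)) {h h' : ℕ} (hne : h ≠ h')
    (hfar : ∀ i i', |D.leadSub i i'| < Nat.dist h h') {ε : ℝ} (hε : 0 < ε) :
    ∃ N₀ : ℕ, ∀ N : ℕ, N₀ ≤ N → ∀ p, D.Admits p → NonnegUpTo p (N + max h h') →
      RCLike.re (mean N fun n => ∫ x, orbitProduct T p f (n + h) x *
        starRingEnd 𝕜 (orbitProduct T p f (n + h') x) ∂μ) ≤
      ‖∏ i, ∫ x, f i x ∂μ‖ ^ 2 + ∑ i, (if D.deg i = 1 then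
        ‖∫ x, f i (T^[(D.lead i).natAbs * Nat.dist h h'] x) * starRingEnd 𝕜 (f i x) ∂μ -
          (∫ x, f i x ∂μ) * starRingEnd 𝕜 (∫ x, f i x ∂μ)‖ else 0) + ε := by
  classical
  -- Each index `i` contributes `p i (n + σ i)`; the nonlinear ones contribute `p i (n + h')` as
  -- well. For linear `p i` the factors are `f i ∘ T ^ α i` and `conj f i ∘ T ^ β i`, both along
  -- `p i (n + σ i)`.
  let J := ι ⊕ {i // D.deg i ≠ 1}
  let σ : ι → ℕ := fun i => if D.deg i = 1 then alignedShift (D.lead i) h h' else h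
  let α : ι → ℕ := fun i => (D.lead i * (h - alignedShift (D.lead i) h h')).toNat
  let β : ι → ℕ := fun i => (D.lead i * (h' - alignedShift (D.lead i) h h')).toNat
  let π : J → ι := Sum.elim id Subtype.val
  let s : J → ℕ := Sum.elim σ fun _ => h'
  let g : J → X → 𝕜 := Sum.elim
    (fun i x => if D.deg i = 1 then f i (T^[α i] x) * starRingEnd 𝕜 (f i (T^[β i] x)) else f i x)
    fun i x => starRingEnd 𝕜 (f i x)
  have hg : ∀ j, UnitBounded (g j) := by
    rintro (i | i)
    · by_cases hi : D.deg i = 1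
      · simp only [g, Sum.elim_inl, hi, if_true]
        exact ((hf i).comp_iterate hT.measurable _).mul
          ((hf i).comp_iterate hT.measurable _).conj
      · simp only [g, Sum.elim_inl, hi, if_false]
        exact hf i
    · exact (hf i).conj
  have hs : ∀ j, s j = h ∨ s j = h' := by
    rintro (i | i)
    · by_cases hi : D.deg i = 1
      · simp only [s, σ, Sum.elim_inl, hi, if_true]
        exact alignedShift_eq_or _ _ _
      · exact Or.inl (by simp only [s, σ, Sum.elim_inl, hi, if_false])
    · exact Or.inr rfl
  have hπs : ∀ j j', j ≠ j' → π j = π j' → D.deg (π j') ≠ 1 ∧ s j ≠ s j' := by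
    rintro (i | i) (i' | i') hjj' heq
    · exact absurd (congrArg Sum.inl heq) hjj'
    · have heq : i = i' := heq
      have hi : D.deg i ≠ 1 := heq ▸ i'.2
      refine ⟨i'.2, ?_⟩
      simpa only [s, σ, Sum.elim_inl, Sum.elim_inr, hi, if_false] using hne
    · have heq : i = i' := heq
      have hi : D.deg i' ≠ 1 := heq ▸ i.2
      refine ⟨hi, ?_⟩
      simpa only [s, σ, Sum.elim_inl, Sum.elim_inr, hi, if_false] using hne.symm
    · exact absurd (congrArg Sum.inr (Subtype.ext heq)) hjj'
  have hdiff : ∀ j j', j ≠ j' → ∃ (e : ℕ) (b : ℤ), ∀ p, D.Admits p →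
      LeadsWith (Polynomial.taylor (s j : ℤ) (p (π j)) -
        Polynomial.taylor (s j' : ℤ) (p (π j'))) e b := by
    intro j j' hjj'
    -- Two shifts of the same nonlinear polynomial, or shifts of two different members.
    by_cases heq : π j = π j'
    · obtain ⟨h1, h2⟩ := hπs j j' hjj' heq
      refine ⟨D.deg (π j') - 1, D.deg (π j') * D.lead (π j') * (s j - s j'), fun p hp => ?_⟩
      rw [heq]
      exact (hp.leadsWith (π j')).taylor_sub_taylor h1 (Nat.cast_injective.ne h2)
    · have hss : (s j : ℤ) = s j' ∨ |D.leadSub (π j) (π j')| < |(s j : ℤ) - s j'| := by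
        have := hfar (π j) (π j')
        rw [natCast_dist] at this
        rcases hs j with h1 | h1 <;> rcases hs j' with h2 | h2 <;> rw [h1, h2]
        · exact Or.inl rfl
        · exact Or.inr this
        · rw [abs_sub_comm (h' : ℤ)]; exact Or.inr this
        · exact Or.inl rfl
      obtain ⟨e, b, heb⟩ := exists_leadsWith_taylor_sub_taylor (D.deg (π j'))
        (D.degSub (π j) (π j')) (D.leadSub (π j) (π j')) (D.lead (π j')) hss
      exact ⟨e, b, fun p hp => heb _ _ (hp.leadsWith_sub _ _ heq) (hp.leadsWith _)⟩
  obtain ⟨i₀, hi₀⟩ := Finite.exists_min D.deg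
  obtain ⟨N₀, hN₀⟩ := hD.exists_norm_mean_integral_sub_le hT hm (π := π)
    (fun i => ⟨Sum.inl i, rfl⟩) (s := fun j => (s j : ℤ)) (j₀ := Sum.inl i₀) hi₀ hdiff hg hε
  refine ⟨N₀, fun N hN p hp hnn => ?_⟩
  have hsle : ∀ j, s j ≤ max h h' := fun j => by rcases hs j with h1 | h1 <;> omega
  have hnnq : NonnegUpTo (fun j => Polynomial.taylor (s j : ℤ) (p (π j))) N := by
    intro j n hn
    rw [Polynomial.taylor_eval, ← Nat.cast_add]
    refine hnn _ _ (Finset.mem_Icc.2 ?_)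
    have := hsle j
    rw [Finset.mem_Icc] at hn
    omega
  have hmain := hN₀ N hN p hp hnnq
  have hterm : ∀ n ∈ Finset.Icc 1 N, ∫ x, orbitProduct T p f (n + h) x *
      starRingEnd 𝕜 (orbitProduct T p f (n + h') x) ∂μ =
      ∫ x, orbitProduct T (fun j => Polynomial.taylor (s j : ℤ) (p (π j))) g n x ∂μ := by
    intro n hn
    refine integral_congr_ae (Eventually.of_forall fun x => ?_)
    simp only [orbitProduct, Polynomial.taylor_eval, ← Nat.cast_add]
    rw [Fintype.prod_sum_type, map_prod, ← Finset.prod_mul_distrib]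
    simp only [g, s, π, Sum.elim_inl, Sum.elim_inr, id]
    rw [Fintype.prod_subtype_eq_prod_ite (fun i => D.deg i ≠ 1)
      (fun i => starRingEnd 𝕜 (f i (T^[((p i).eval ((n + h' : ℕ) : ℤ)).toNat] x))),
      ← Finset.prod_mul_distrib]
    refine Finset.prod_congr rfl fun i _ => ?_
    by_cases hi : D.deg i = 1
    · have hlead := hp.leadsWith i
      rw [hi] at hlead
      obtain ⟨ha, hb⟩ := mul_sub_alignedShift_nonneg (D.lead i) h h'
      have hpos := hnnq (Sum.inl i) n hn
      simp only [Polynomial.taylor_eval, s, σ, π, Sum.elim_inl, hi, if_true, id,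
        ← Nat.cast_add] at hpos
      have heval : ∀ k : ℕ, 0 ≤ D.lead i * (k - alignedShift (D.lead i) h h' : ℤ) →
          ((p i).eval ((n + k : ℕ) : ℤ)).toNat =
            (D.lead i * (k - alignedShift (D.lead i) h h' : ℤ)).toNat +
              ((p i).eval ((n + alignedShift (D.lead i) h h' : ℕ) : ℤ)).toNat := by
        intro k hk
        rw [← Int.toNat_add hk hpos, add_comm (D.lead i * _), ← hlead.eval_add_of_deg_one]
        congr 2
        push_cast
        ring
      simp only [hi, if_true, ne_eq, not_true_eq_false, if_false, mul_one, σ, α, β,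
        ← Function.iterate_add_apply]
      rw [heval h ha, heval h' hb]
    · simp only [hi, if_false, ne_eq, not_false_eq_true, if_true, σ]
  rw [mean_congr hterm]
  have hγ : ∏ j, ∫ x, g j x ∂μ = ∏ i, if D.deg i = 1 then
      ∫ x, f i (T^[α i] x) * starRingEnd 𝕜 (f i (T^[β i] x)) ∂μ else
        (∫ x, f i x ∂μ) * starRingEnd 𝕜 (∫ x, f i x ∂μ) := by
    rw [Fintype.prod_sum_type]
    simp only [g, Sum.elim_inl, Sum.elim_inr]
    rw [Fintype.prod_subtype_eq_prod_ite (fun i => D.deg i ≠ 1)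
      (fun i => ∫ x, starRingEnd 𝕜 (f i x) ∂μ), ← Finset.prod_mul_distrib]
    refine Finset.prod_congr rfl fun i _ => ?_
    by_cases hi : D.deg i = 1
    · simp [hi]
    · simp [hi, integral_conj]
  have hL : ((‖∏ i, ∫ x, f i x ∂μ‖ ^ 2 : ℝ) : 𝕜) =
      ∏ i, (∫ x, f i x ∂μ) * starRingEnd 𝕜 (∫ x, f i x ∂μ) := by
    rw [Finset.prod_mul_distrib, ← map_prod, RCLike.mul_conj]
    norm_cast
  have hclose : ‖∏ j, ∫ x, g j x ∂μ - ((‖∏ i, ∫ x, f i x ∂μ‖ ^ 2 : ℝ) : 𝕜)‖ ≤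
      ∑ i, (if D.deg i = 1 then
        ‖∫ x, f i (T^[(D.lead i).natAbs * Nat.dist h h'] x) * starRingEnd 𝕜 (f i x) ∂μ -
          (∫ x, f i x ∂μ) * starRingEnd 𝕜 (∫ x, f i x ∂μ)‖ else 0) := by
    have hsq : ∀ i, ‖(∫ x, f i x ∂μ) * starRingEnd 𝕜 (∫ x, f i x ∂μ)‖ ≤ 1 := fun i => by
      rw [norm_mul, RCLike.norm_conj]
      exact mul_le_one₀ (hf i).norm_integral_le_one (norm_nonneg _) (hf i).norm_integral_le_one
    rw [hγ, hL]
    refine (norm_prod_sub_prod_le _ (fun i _ => ?_) fun i _ => hsq i).trans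
      (Finset.sum_le_sum fun i _ => ?_)
    · split_ifs
      · exact (((hf i).comp_iterate hT.measurable _).mul
          ((hf i).comp_iterate hT.measurable _).conj).norm_integral_le_one
      · exact hsq i
    · split_ifs
      · rw [norm_correlation_comp_iterate hT (hf i), dist_toNat_mul_sub_alignedShift]
      · simp
  have h1 := RCLike.re_le_norm (mean N (fun n => ∫ x,
    orbitProduct T (fun j => Polynomial.taylor (s j : ℤ) (p (π j))) g n x ∂μ) -
      ((‖∏ i, ∫ x, f i x ∂μ‖ ^ 2 : ℝ) : 𝕜))
  rw [map_sub, RCLike.ofReal_re] at h1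
  have h2 := norm_sub_le_norm_sub_add_norm_sub (mean N (fun n => ∫ x,
    orbitProduct T (fun j => Polynomial.taylor (s j : ℤ) (p (π j))) g n x ∂μ))
      (∏ j, ∫ x, g j x ∂μ) ((‖∏ i, ∫ x, f i x ∂μ‖ ^ 2 : ℝ) : 𝕜)
  linarith

end Step

/-! ### The PET induction -/

section Induction

variable {X 𝕜 : Type*} [MeasurableSpace X] [RCLike 𝕜] {μ : Measure X} [IsProbabilityMeasure μ]
  {T : X → X} {ι : Type} [Fintype ι]

theorem integral_van_der_corput {u : ℕ → X → 𝕜} (hu : ∀ n, UnitBounded (u n)) (N : ℕ) {H : ℕ}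
    (hH : 0 < H) :
    ∫ x, ‖mean N (fun n => u n x)‖ ^ 2 ∂μ ≤
      ((H : ℝ) ^ 2)⁻¹ * ∑ h ∈ Finset.Icc 1 H, ∑ h' ∈ Finset.Icc 1 H,
        RCLike.re (mean N fun n => ∫ x, u (n + h) x * starRingEnd 𝕜 (u (n + h') x) ∂μ) +
      4 * H / N := by
  have hc : ∀ h h' n, UnitBounded fun x => u (n + h) x * starRingEnd 𝕜 (u (n + h') x) :=
    fun h h' n => (hu _).mul (hu _).conj
  have hi : ∀ h h', Integrable (fun x => RCLike.re
      (mean N fun n => u (n + h) x * starRingEnd 𝕜 (u (n + h') x))) μ :=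
    fun h h' => (UnitBounded.mean (hc h h') N).integrable.re
  have hi1 : Integrable (fun x => ∑ h ∈ Finset.Icc 1 H, ∑ h' ∈ Finset.Icc 1 H,
      RCLike.re (mean N fun n => u (n + h) x * starRingEnd 𝕜 (u (n + h') x))) μ :=
    integrable_finsetSum _ fun h _ => integrable_finsetSum _ fun h' _ => hi h h'
  have hsq : Integrable (fun x => ‖mean N (fun n => u n x)‖ ^ 2) μ := by
    simpa using (UnitBounded.mean hu N).integrable_norm_sub_sq (μ := μ) 0
  refine (integral_mono hsq ((hi1.const_mul _).add (integrable_const (4 * (H : ℝ) / N)))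
    fun x => van_der_corput (fun n => (hu n).norm_le_one x) N hH).trans_eq ?_
  simp only [Pi.add_apply]
  rw [integral_add (hi1.const_mul _) (integrable_const _), integral_const_mul,
    integral_finsetSum _ fun h _ => integrable_finsetSum _ fun h' _ => hi h h']
  congr 2
  · refine Finset.sum_congr rfl fun h _ => ?_
    rw [integral_finsetSum _ fun h' _ => hi h h']
    refine Finset.sum_congr rfl fun h' _ => ?_
    rw [integral_re (UnitBounded.mean (hc h h') N).integrable,
      UnitBounded.integral_mean (hc h h')]
  · simp

/-- The limit superior of the squared `L²` norms of the averages is at most `|∏ i, ∫ f i|²`,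
uniformly in `p`. -/
theorem ConvergesBelow.exists_integral_norm_sq_mean_le (hT : IsWeaklyMixing T μ)
    {D : LeadingData ι} {m : ℕ} (hm : ∀ i, D.deg i ≤ m) (hD : ConvergesBelow 𝕜 T μ m D)
    (hlead : ∀ i, D.lead i ≠ 0)
    [Nonempty ι] {f : ι → X → 𝕜} (hf : ∀ i, UnitBounded (f i)) {ε : ℝ} (hε : 0 < ε) :
    ∃ H N₀ : ℕ, ∀ N : ℕ, N₀ ≤ N → ∀ p, D.Admits p → NonnegUpTo p (N + H) →
      ∫ x, ‖mean N (fun n => orbitProduct T p f n x)‖ ^ 2 ∂μ ≤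
        ‖∏ i, ∫ x, f i x ∂μ‖ ^ 2 + 3 * ε := by
  set L : 𝕜 := ∏ i, ∫ x, f i x ∂μ with hL
  set φ : ι → ℕ → ℝ := fun i k =>
    ‖∫ x, f i (T^[k] x) * starRingEnd 𝕜 (f i x) ∂μ -
      (∫ x, f i x ∂μ) * starRingEnd 𝕜 (∫ x, f i x ∂μ)‖ with hφ
  -- Pairs `h, h'` at distance less than `M` may produce constant differences. There the trivial
  -- bound `1` is used, which is absorbed by the indicator in `ψ`.
  set M : ℕ := 1 + ∑ i, ∑ i', (D.leadSub i i').natAbs with hM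
  have hMlt : ∀ i i', |D.leadSub i i'| < (M : ℤ) := by
    intro i i'
    have h1 : (D.leadSub i i').natAbs ≤ ∑ i', (D.leadSub i i').natAbs :=
      Finset.single_le_sum (f := fun i' => (D.leadSub i i').natAbs)
        (fun _ _ => Nat.zero_le _) (Finset.mem_univ i')
    have h2 : ∑ i', (D.leadSub i i').natAbs ≤ ∑ i, ∑ i', (D.leadSub i i').natAbs :=
      Finset.single_le_sum (f := fun i => ∑ i', (D.leadSub i i').natAbs)
        (fun _ _ => Nat.zero_le _) (Finset.mem_univ i)
    rw [Int.abs_eq_natAbs]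
    omega
  set ψ : ℕ → ℝ := fun k =>
    ∑ i, (if D.deg i = 1 then φ i ((D.lead i).natAbs * k) else 0) + if k < M then 1 else 0 with hψ
  have hsum0 : ∀ k, 0 ≤ ∑ i, (if D.deg i = 1 then φ i ((D.lead i).natAbs * k) else 0) :=
    fun k => Finset.sum_nonneg fun i _ => by
      split_ifs
      · exact norm_nonneg _
      · exact le_rfl
  have hψ0 : ∀ k, 0 ≤ ψ k := fun k => add_nonneg (hsum0 k) (by split_ifs <;> norm_num)
  have hψnull : NullInMean ψ := by
    refine NullInMean.add (NullInMean.sum fun i _ => ?_) (NullInMean.indicator_lt M)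
    by_cases hi : D.deg i = 1
    · simpa only [hi, if_true] using (hT.nullInMean_correlation (hf i)).comp_mul
        (fun _ => norm_nonneg _) (Int.natAbs_pos.2 (hlead i))
    · simp [hi, NullInMean]
  obtain ⟨H, hH, hHψ⟩ := hψnull.exists_double_average_le hψ0 hε
  have hTm := hT.measurePreserving.measurable
  have hpair : ∀ h h' : ℕ, ∃ N₀ : ℕ, ∀ N : ℕ, N₀ ≤ N → ∀ p, D.Admits p →
      NonnegUpTo p (N + max h h') →
      RCLike.re (mean N fun n => ∫ x, orbitProduct T p f (n + h) x *
        starRingEnd 𝕜 (orbitProduct T p f (n + h') x) ∂μ) ≤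
      ‖L‖ ^ 2 + ψ (Nat.dist h h') + ε := by
    intro h h'
    by_cases hnear : Nat.dist h h' < M
    · refine ⟨0, fun N _ p _ _ => ?_⟩
      have h1 := (RCLike.re_le_norm _).trans (norm_mean_le_one (N := N) fun n =>
        ((UnitBounded.orbitProduct hTm hf p (n + h)).mul
          (UnitBounded.orbitProduct hTm hf p (n + h')).conj).norm_integral_le_one (μ := μ))
      have h2 : 1 ≤ ψ (Nat.dist h h') := by
        simp only [hψ, hnear, if_true]
        linarith [hsum0 (Nat.dist h h')]
      linarith [sq_nonneg ‖L‖]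
    · have hne : h ≠ h' := by
        rintro rfl
        rw [Nat.dist_self] at hnear
        omega
      obtain ⟨N₀, hN₀⟩ := exists_re_mean_integral_mul_conj_le hT.measurePreserving hm hD hf hne
        (fun i i' => (hMlt i i').trans_le (by exact_mod_cast not_lt.1 hnear)) hε
      refine ⟨N₀, fun N hN p hp hnn => (hN₀ N hN p hp hnn).trans_eq ?_⟩
      simp only [hψ, hnear, if_false, add_zero, hφ, hL]
  choose N₀ hN₀ using hpair
  obtain ⟨N₁, hN₁⟩ := exists_nat_gt (4 * H / ε)
  refine ⟨H, N₁ + ∑ h ∈ Finset.Icc 1 H, ∑ h' ∈ Finset.Icc 1 H, N₀ h h', fun N hN p hp hnn => ?_⟩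
  have hterm : ∀ h ∈ Finset.Icc 1 H, ∀ h' ∈ Finset.Icc 1 H,
      RCLike.re (mean N fun n => ∫ x, orbitProduct T p f (n + h) x *
        starRingEnd 𝕜 (orbitProduct T p f (n + h') x) ∂μ) ≤
      ‖L‖ ^ 2 + ψ (Nat.dist h h') + ε := by
    intro h hh h' hh'
    have h1 : N₀ h h' ≤ ∑ h' ∈ Finset.Icc 1 H, N₀ h h' :=
      Finset.single_le_sum (fun _ _ => Nat.zero_le _) hh'
    have h2 : ∑ h' ∈ Finset.Icc 1 H, N₀ h h' ≤
        ∑ h ∈ Finset.Icc 1 H, ∑ h' ∈ Finset.Icc 1 H, N₀ h h' :=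
      Finset.single_le_sum (f := fun h => ∑ h' ∈ Finset.Icc 1 H, N₀ h h')
        (fun _ _ => Nat.zero_le _) hh
    refine hN₀ h h' N (by omega) p hp fun i n hn => hnn i n ?_
    simp only [Finset.mem_Icc] at hh hh' hn ⊢
    omega
  have hHpos : (0 : ℝ) < H := by exact_mod_cast hH
  have hNN₁ : 4 * H / ε < (N : ℝ) := hN₁.trans_le (by exact_mod_cast (by omega : N₁ ≤ N))
  have hNpos : (0 : ℝ) < N := lt_of_le_of_lt (by positivity) hNN₁
  have herr : 4 * H / (N : ℝ) ≤ ε := by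
    rw [div_le_iff₀ hNpos]
    rw [div_lt_iff₀ hε] at hNN₁
    linarith
  refine (integral_van_der_corput (fun n => UnitBounded.orbitProduct hTm hf p n) N hH).trans ?_
  have hbound : ((H : ℝ) ^ 2)⁻¹ * ∑ h ∈ Finset.Icc 1 H, ∑ h' ∈ Finset.Icc 1 H,
      RCLike.re (mean N fun n => ∫ x, orbitProduct T p f (n + h) x *
        starRingEnd 𝕜 (orbitProduct T p f (n + h') x) ∂μ) ≤ ‖L‖ ^ 2 + ε + ε := by
    calc _ ≤ ((H : ℝ) ^ 2)⁻¹ * ∑ h ∈ Finset.Icc 1 H, ∑ h' ∈ Finset.Icc 1 H,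
          (‖L‖ ^ 2 + ψ (Nat.dist h h') + ε) := by
          gcongr with h hh h' hh'
          exact hterm h hh h' hh'
      _ = ‖L‖ ^ 2 + ε + ((H : ℝ) ^ 2)⁻¹ *
          ∑ h ∈ Finset.Icc 1 H, ∑ h' ∈ Finset.Icc 1 H, ψ (Nat.dist h h') := by
          simp only [Finset.sum_add_distrib, Finset.sum_const, Nat.card_Icc, Nat.add_sub_cancel,
            nsmul_eq_mul]
          field_simp
          ring
      _ ≤ _ := by linarith
  linarith

theorem ConvergesBelow.uniformlyConverges (hT : IsWeaklyMixing T μ)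
    {D : LeadingData ι} {m : ℕ} (hm : ∀ i, D.deg i ≤ m) (hD : ConvergesBelow 𝕜 T μ m D) :
    UniformlyConverges 𝕜 T μ D := by
  intro f hf ε hε
  by_cases hex : ∃ p, D.Admits p
  swap
  · exact ⟨0, fun N _ p hp => absurd ⟨p, hp⟩ hex⟩
  obtain ⟨p₀, hp₀⟩ := hex
  rcases isEmpty_or_nonempty ι with hι | hι
  · refine ⟨1, fun N hN p _ _ => ?_⟩
    simp only [orbitProduct, Finset.univ_eq_empty, Finset.prod_empty]
    rw [mean_const hN]
    simpa using hε.le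
  have hε5 : 0 < ε / 5 := by positivity
  have hTm := hT.measurePreserving.measurable
  obtain ⟨H, N₁, hN₁⟩ := hD.exists_integral_norm_sq_mean_le hT hm
    (fun i => (hp₀.leadsWith i).ne_zero) hf hε5
  obtain ⟨i₀, hi₀⟩ := Finite.exists_min D.deg
  obtain ⟨N₂, hN₂⟩ := hD.exists_norm_mean_integral_sub_le hT.measurePreserving hm (π := fun i => i)
    Function.surjective_id (s := fun _ => 0) (j₀ := i₀) hi₀
    (fun i j hij => ⟨_, _, fun p hp => by
      simpa only [Polynomial.taylor_zero] using hp.leadsWith_sub i j hij⟩) hf hε5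
  refine ⟨max N₁ N₂, fun N hN p hp hnn => ?_⟩
  obtain ⟨K, hK⟩ := exists_shift_nonneg p (N + H)
  -- The van der Corput inequality looks at exponents up to `N + H`, beyond the range where `p` is
  -- known to be non-negative.
  rw [← integral_norm_sq_mean_shift hT.measurePreserving hf hnn K]
  set q : ι → Polynomial ℤ := fun i => p i + Polynomial.C (K : ℤ) with hq
  have hqa : D.Admits q := hp.add_C K
  have hu := fun n => UnitBounded.orbitProduct hTm hf q n
  have hA := UnitBounded.mean hu N
  have h1 := hN₁ N ((le_max_left _ _).trans hN) q hqa hK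
  have h2 := hN₂ N ((le_max_right _ _).trans hN) q hqa fun i n hn => by
    beta_reduce
    rw [Polynomial.taylor_zero]
    refine hK i n ?_
    rw [Finset.mem_Icc] at hn ⊢
    omega
  simp only [Polynomial.taylor_zero] at h2
  rw [← UnitBounded.integral_mean hu] at h2
  have hsq : Integrable (fun x => ‖mean N (fun n => orbitProduct T q f n x)‖ ^ 2) μ := by
    simpa using hA.integrable_norm_sub_sq (μ := μ) 0
  rw [integral_norm_sub_sq hA.integrable hsq]
  have hL1 : ‖∏ i, ∫ x, f i x ∂μ‖ ≤ 1 := by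
    rw [norm_prod]
    exact Finset.prod_le_one (fun _ _ => norm_nonneg _) fun i _ => (hf i).norm_integral_le_one
  generalize (∏ i, ∫ x, f i x ∂μ) = L at *
  generalize (∫ x, mean N (fun n => orbitProduct T q f n x) ∂μ) = a at *
  have h3 : ‖L‖ ^ 2 - ε / 5 ≤ RCLike.re (starRingEnd 𝕜 L * a) := by
    have h4 : RCLike.re (starRingEnd 𝕜 L * (L - a)) ≤ ε / 5 := by
      refine (RCLike.re_le_norm _).trans ?_
      rw [norm_mul, RCLike.norm_conj, norm_sub_rev]
      exact (mul_le_of_le_one_left (norm_nonneg _) hL1).trans h2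
    rw [mul_sub, map_sub, RCLike.conj_mul] at h4
    norm_cast at h4
    linarith
  linarith

theorem uniformlyConverges (hT : IsWeaklyMixing T μ) (D : LeadingData ι) :
    UniformlyConverges 𝕜 T μ D := by
  have key : ∀ (m : ℕ) (w : Fin (m + 1) → ℕ) (κ : Type) [Fintype κ] (D : LeadingData κ),
      (∀ i, D.deg i ≤ m) → D.weight m = w → UniformlyConverges 𝕜 T μ D := by
    intro m w
    induction w using (LeadingData.wellFounded_weightLT m).induction with
    | _ w ih =>
      intro κ _ D hm hw
      refine ConvergesBelow.uniformlyConverges hT hm fun κ' _ D' hm' hlt => ?_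
      exact ih _ (hw ▸ hlt) κ' D' hm' rfl
  exact key (∑ i, D.deg i) _ ι D
    (fun i => Finset.single_le_sum (fun _ _ => Nat.zero_le _) (Finset.mem_univ i)) rfl

end Induction

/-! ### Integer iterates and essentially bounded functions -/

section Final

variable {X 𝕜 : Type*} [MeasurableSpace X] [RCLike 𝕜]

theorem intIterate_iterate {T : X → X} {k : ℤ} (hk : IsInvertibleMap T ∨ 0 ≤ k) {K : ℕ}
    (hkK : 0 ≤ k + K) (x : X) : intIterate T k (T^[K] x) = T^[(k + K).toNat] x := by
  rcases le_or_gt 0 k with h | h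
  · obtain ⟨n, rfl⟩ := Int.eq_ofNat_of_zero_le h
    rw [intIterate_natCast, ← Function.iterate_add_apply, ← Nat.cast_add, Int.toNat_natCast]
  · obtain ⟨S, -, h₁, h₂⟩ := hk.resolve_right h.not_ge
    obtain ⟨n, rfl⟩ := Int.exists_eq_neg_ofNat h.le
    obtain ⟨m, rfl⟩ : ∃ m, K = n + m := Nat.exists_eq_add_of_le (by omega)
    rw [intIterate_neg_natCast h₁ h₂, Function.iterate_add_apply, h₁.iterate n]
    congr 1
    omega

/-- After composition with a high iterate of `T`, only natural iterates occur in the average. -/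
theorem polyAverage_iterate {T : X → X} {r : ℕ} {q : Fin r → Polynomial ℤ} {N : ℕ}
    (hq : IsInvertibleMap T ∨ NonnegUpTo q N) {K : ℕ}
    (hK : NonnegUpTo (fun i => q i + Polynomial.C (K : ℤ)) N) (f : Fin r → X → 𝕜) (x : X) :
    polyAverage T q f N (T^[K] x) =
      mean N fun n => orbitProduct T (fun i => q i + Polynomial.C (K : ℤ)) f n x := by
  rw [polyAverage, mean]
  congr 1
  refine Finset.sum_congr rfl fun n hn => Finset.prod_congr rfl fun i _ => ?_
  have := hK i n hn
  simp only [Polynomial.eval_add, Polynomial.eval_C] at this ⊢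
  rw [intIterate_iterate (hq.imp_right fun h => h i n hn) this]

theorem intIterate_measurePreserving {μ : Measure X} {T : X → X} (hT : MeasurePreserving T μ μ)
    {k : ℤ} (hk : IsInvertibleMap T ∨ 0 ≤ k) : MeasurePreserving (intIterate T k) μ μ := by
  rcases le_or_gt 0 k with h | h
  · obtain ⟨n, rfl⟩ := Int.eq_ofNat_of_zero_le h
    exact hT.iterate n
  · obtain ⟨S, hS, h₁, h₂⟩ := hk.resolve_right h.not_ge
    obtain ⟨n, rfl⟩ := Int.exists_eq_neg_ofNat h.le
    rw [intIterate_neg_natCast h₁ h₂]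
    refine MeasurePreserving.iterate ⟨hS, ?_⟩ n
    conv_lhs => rw [← hT.map_eq]
    rw [Measure.map_map hS hT.measurable, h₁.comp_eq_id, Measure.map_id]

theorem exists_unitBounded_ae_eq {μ : Measure X} {f : X → 𝕜} (hf : MemLp f ⊤ μ) :
    ∃ (B : ℝ) (g : X → 𝕜), 0 < B ∧ UnitBounded g ∧ f =ᵐ[μ] fun x => (B : 𝕜) * g x := by
  obtain ⟨hfm, hfb⟩ := hf
  set B : ℝ := (eLpNorm f ⊤ μ).toReal + 1 with hB
  have hBpos : 0 < B := by positivity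
  have hB0 : (B : 𝕜) ≠ 0 := by exact_mod_cast hBpos.ne'
  set f' := hfm.mk f with hf'
  have hf'm : StronglyMeasurable f' := hfm.stronglyMeasurable_mk
  set A : Set X := {x | ‖f' x‖ ≤ B} with hA
  have hAm : MeasurableSet A := hf'm.norm.measurable measurableSet_Iic
  refine ⟨B, A.indicator fun x => (B : 𝕜)⁻¹ * f' x, hBpos,
    ⟨(hf'm.const_mul _).indicator hAm, fun x => ?_⟩, ?_⟩
  · by_cases hx : x ∈ A
    · have hx' : ‖f' x‖ ≤ B := hx
      rw [Set.indicator_of_mem hx, norm_mul, norm_inv, RCLike.norm_ofReal, abs_of_pos hBpos,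
        inv_mul_le_iff₀ hBpos, mul_one]
      exact hx'
    · rw [Set.indicator_of_notMem hx, norm_zero]
      exact zero_le_one
  · filter_upwards [hfm.ae_eq_mk, ae_le_eLpNormEssSup (f := f) (μ := μ)] with x hx hxb
    have hxA : x ∈ A := by
      change ‖hfm.mk f x‖ ≤ B
      rw [← hx]
      rw [← eLpNorm_exponent_top] at hxb
      have := ENNReal.toReal_mono hfb.ne hxb
      rw [toReal_enorm] at this
      linarith
    rw [Set.indicator_of_mem hxA, mul_inv_cancel_left₀ hB0, hx]

theorem polyAverage_ae_eq {μ : Measure X} {T : X → X} (hT : MeasurePreserving T μ μ) {r : ℕ}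
    {q : Fin r → Polynomial ℤ} {N : ℕ} (hq : IsInvertibleMap T ∨ NonnegUpTo q N)
    {f g : Fin r → X → 𝕜} {B : Fin r → ℝ} (hfg : ∀ i, f i =ᵐ[μ] fun x => (B i : 𝕜) * g i x) :
    polyAverage T q f N =ᵐ[μ] fun x => (∏ i, (B i : 𝕜)) * polyAverage T q g N x := by
  have h : ∀ᵐ x ∂μ, ∀ n ∈ Finset.Icc 1 N, ∀ i, f i (intIterate T ((q i).eval (n : ℤ)) x) =
      (B i : 𝕜) * g i (intIterate T ((q i).eval (n : ℤ)) x) := by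
    refine (Filter.eventually_all_finset _).2 fun n hn => Filter.eventually_all.2 fun i => ?_
    exact (intIterate_measurePreserving hT
      (hq.imp_right fun h => h i n hn)).quasiMeasurePreserving.ae (hfg i)
  filter_upwards [h] with x hx
  rw [polyAverage, polyAverage, mul_left_comm]
  congr 1
  rw [Finset.mul_sum]
  refine Finset.sum_congr rfl fun n hn => ?_
  rw [← Finset.prod_mul_distrib]
  exact Finset.prod_congr rfl fun i _ => hx n hn i

theorem stronglyMeasurable_polyAverage {μ : Measure X} {T : X → X} (hT : MeasurePreserving T μ μ)
    {r : ℕ} {q : Fin r → Polynomial ℤ} {N : ℕ} (hq : IsInvertibleMap T ∨ NonnegUpTo q N)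
    {g : Fin r → X → 𝕜} (hg : ∀ i, UnitBounded (g i)) :
    StronglyMeasurable (polyAverage T q g N) := by
  refine (Finset.stronglyMeasurable_fun_sum _ fun n hn =>
    Finset.stronglyMeasurable_fun_prod _ fun i _ => ?_).const_mul _
  exact (hg i).stronglyMeasurable.comp_measurable
    (intIterate_measurePreserving hT (hq.imp_right fun h => h i n hn)).measurable

theorem eLpNorm_two_le_ofReal {μ : Measure X} {F : X → 𝕜} (hF : MemLp F 2 μ) {δ : ℝ} (hδ : 0 ≤ δ)
    (h : ∫ x, ‖F x‖ ^ 2 ∂μ ≤ δ ^ 2) : eLpNorm F 2 μ ≤ ENNReal.ofReal δ := by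
  rw [hF.eLpNorm_eq_integral_rpow_norm two_ne_zero ENNReal.ofNat_ne_top]
  refine ENNReal.ofReal_le_ofReal ?_
  simp only [ENNReal.toReal_ofNat, Real.rpow_ofNat]
  rw [show (2 : ℝ)⁻¹ = 1 / 2 by norm_num, ← Real.sqrt_eq_rpow]
  exact Real.sqrt_le_iff.2 ⟨hδ, h⟩

theorem UniformlyAdmissible.exists_leadingData {I : Type*} {r : ℕ} {p : I → Fin r → Polynomial ℤ}
    (hp : UniformlyAdmissible p) : ∃ D : LeadingData (Fin r), ∀ t, D.Admits (p t) := by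
  rcases isEmpty_or_nonempty I with hI | ⟨⟨t₀⟩⟩
  · exact ⟨⟨0, 0, 0, 0⟩, fun t => hI.elim t⟩
  · refine ⟨⟨fun i => (p t₀ i).natDegree, fun i => (p t₀ i).leadingCoeff,
      fun i j => (p t₀ i - p t₀ j).natDegree, fun i j => (p t₀ i - p t₀ j).leadingCoeff⟩,
      fun t => ⟨fun i => ?_, fun i j hij => ?_⟩⟩
    · simp only [hp.natDegree_eq t₀ t i, hp.leadingCoeff_eq t₀ t i]
      exact LeadsWith.of_leadingCoeff_eq (hp.natDegree_pos t i)
    · simp only [hp.natDegree_sub_eq t₀ t i j hij, hp.leadingCoeff_sub_eq t₀ t i j hij]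
      exact LeadsWith.of_leadingCoeff_eq (hp.natDegree_sub_pos t i j hij)

end Final

theorem theorem3p2 {X : Type*} [MeasurableSpace X] (μ : Measure X) [IsProbabilityMeasure μ]
    (T : X → X) (hT : IsWeaklyMixing T μ)
    {I : Type*} {r : ℕ} (p : I → Fin r → Polynomial ℤ) (hp : UniformlyAdmissible p)
    {𝕜 : Type*} [RCLike 𝕜] (f : Fin r → X → 𝕜) (hf : ∀ i, MemLp (f i) ⊤ μ) :
    ∀ ε : ENNReal, 0 < ε → ∃ N₀ : ℕ, ∀ N : ℕ, N₀ ≤ N → ∀ t : I,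
      (IsInvertibleMap T ∨ ∀ i, ∀ n ∈ Finset.Icc 1 N, 0 ≤ (p t i).eval (n : ℤ)) →
        eLpNorm (fun x => polyAverage T (p t) f N x - ∏ i, ∫ y, f i y ∂μ) 2 μ < ε := by
  intro ε hε
  have hmp := hT.measurePreserving
  choose B g hB hg hfg using fun i => exists_unitBounded_ae_eq (hf i)
  obtain ⟨D, hD⟩ := hp.exists_leadingData
  obtain ⟨e, he, heε⟩ : ∃ e : ℝ, 0 < e ∧ ENNReal.ofReal e < ε := by
    obtain ⟨e, he0, he⟩ := ENNReal.lt_iff_exists_real_btwn.1 hε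
    exact ⟨e, ENNReal.ofReal_pos.1 he.1, he.2⟩
  have hP : 0 < ∏ i, B i := Finset.prod_pos fun i _ => hB i
  obtain ⟨N₀, hN₀⟩ := uniformlyConverges (𝕜 := 𝕜) hT D g hg ((e / ∏ i, B i) ^ 2) (by positivity)
  refine ⟨N₀, fun N hN t ht => ?_⟩
  obtain ⟨K, hK⟩ := exists_shift_nonneg (p t) N
  set L : 𝕜 := ∏ i, ∫ y, g i y ∂μ with hL
  set F : X → 𝕜 := fun x => polyAverage T (p t) g N x - L with hF
  have hprod : ∏ i, ∫ y, f i y ∂μ = (∏ i, (B i : 𝕜)) * L := by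
    rw [hL, ← Finset.prod_mul_distrib]
    refine Finset.prod_congr rfl fun i _ => ?_
    rw [integral_congr_ae (hfg i), integral_const_mul]
  have hscale : (fun x => polyAverage T (p t) f N x - ∏ i, ∫ y, f i y ∂μ) =ᵐ[μ]
      (∏ i, (B i : 𝕜)) • F := by
    filter_upwards [polyAverage_ae_eq hmp ht hfg] with x hx
    rw [hx, hprod, ← mul_sub, Pi.smul_apply, smul_eq_mul]
  have hFm : StronglyMeasurable F :=
    (stronglyMeasurable_polyAverage hmp ht hg).sub stronglyMeasurable_const
  have hFK : F ∘ T^[K] = fun x =>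
      mean N (fun n => orbitProduct T (fun i => p t i + Polynomial.C (K : ℤ)) g n x) - L :=
    funext fun x => by simp only [hF, Function.comp_apply, polyAverage_iterate ht hK]
  have hmem : MemLp (F ∘ T^[K]) 2 μ := by
    rw [hFK]
    have := UnitBounded.mean (UnitBounded.orbitProduct hmp.measurable hg
      fun i => p t i + Polynomial.C (K : ℤ)) N
    exact (MemLp.of_bound this.stronglyMeasurable.aestronglyMeasurable 1
      (Eventually.of_forall this.norm_le_one)).sub (memLp_const L)
  have hFle : eLpNorm F 2 μ ≤ ENNReal.ofReal (e / ∏ i, B i) := by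
    rw [← eLpNorm_comp_measurePreserving hFm.aestronglyMeasurable (hmp.iterate K)]
    refine eLpNorm_two_le_ofReal hmem (by positivity) ?_
    rw [hFK]
    exact hN₀ N hN _ ((hD t).add_C K) hK
  calc eLpNorm (fun x => polyAverage T (p t) f N x - ∏ i, ∫ y, f i y ∂μ) 2 μ
      = ‖∏ i, (B i : 𝕜)‖ₑ * eLpNorm F 2 μ := by
        rw [eLpNorm_congr_ae hscale, eLpNorm_const_smul]
    _ ≤ ENNReal.ofReal (∏ i, B i) * ENNReal.ofReal (e / ∏ i, B i) := by
        refine mul_le_mul' (le_of_eq ?_) hFle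
        rw [← ofReal_norm, ← RCLike.ofReal_prod, RCLike.norm_ofReal, abs_of_pos hP]
    _ = ENNReal.ofReal e := by
        rw [← ENNReal.ofReal_mul hP.le, mul_div_cancel₀ _ hP.ne']
    _ < ε := heε
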